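/- Throughout, $\log$ is the binary logarithm, $d\ge 1$ and $T\ge 2$ are integers, $0<\epsilon\le 1$, $0<\beta<1$, and $x=x^1,\dots,x^T$ is a stream of rows in $\{0,1\}^d$. Let $c_i^t=\sum_{t'\le t}x_i^{t'}$ and let $\textsc{MaxSum}$ at time $t$ be $M_t=\max_i c_i^t$. Put $c_{\max}=\max(1,M_T)$. A randomized algorithm with outputs $a^1,\dots,a^T$ is $(\alpha,\beta')$-accurate for $\textsc{MaxSum}$ on $x$ if $\Pr[\max_{t}|M_t-a^t|>\alpha]<\beta'$. $\mathrm{Lap}(b)$ is the Laplace distribution centred at $0$ with scale $b$; all noise variables below are fresh and independent. **Two-level mechanism.** Its parameters are $T,\epsilon,\beta$, numbers $L_1,L_2,\dots$ and $\beta_{\mathrm{in}}$. For each $j\ge 1$ put $$\alpha_\Gamma^{(j)}=\tfrac{4\sqrt2}{\epsilon}d\sqrt{L_j}\log\tfrac{3d\log T}{\beta},\qquad \alpha_{DM}^{(j)}=\tfrac{12}{\epsilon}\log\tfrac{3T}{\beta}+\alpha_\Gamma^{(j)}+L_j,\qquad \Delta_j=2^{j-1}+2\alpha_{DM}^{(j)},$$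 $$\mathrm{err}(n)=4(\epsilon/2)^{-1}d\log n\,\log\tfrac{6dn}{\beta_{\mathrm{in}}},\qquad K^{(j)}=3\Bigl(\alpha_\Gamma^{(j)}+\mathrm{err}(\Delta_j)+\tfrac8\epsilon\log\tfrac{3T}{\beta_{\mathrm{in}}}+\tfrac4\epsilon\log\tfrac{3\Delta_j}{\beta_{\mathrm{in}}}\Bigr).$$ *Outer level.* Start with $j=1$, $s=0\in\mathbb R^d$, threshold $\tilde K_1=1+\mathrm{Lap}(4/\epsilon)$ and an inner instance for segment $1$ with base $s$. At time $t$ set $s\leftarrow s+x^t$. If $\max_i s_i+\mathrm{Lap}(8/\epsilon)>\tilde K_j$ and $j<\log T$, then add independent $\mathrm{Lap}(2d/\epsilon)$ noise to each $s_i$, set $j\leftarrow j+1$ and $\tilde K_j=2^{j-1}+\mathrm{Lap}(4/\epsilon)$, replace the inner instance by a new one for segment $j$ with base $s$, and output $\max_i s_i$. Otherwise feed $x^t$ to the inner instance and output its output. *Inner instance for segment $j$ with base $b\in\mathbb R^d$.* Start with $l=1$, $c=0$, $s=b$, $\mathrm{out}=\max_i b_i$. When a row $x^t$ is fed, set $c\leftarrow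 c+x^t$ and $s\leftarrow s+x^t$. If $\max_i s_i+\mathrm{Lap}(8/\epsilon)>\max_i b_i+l\,K^{(j)}+\tau_l$, where $\tau_l\sim\mathrm{Lap}(4/\epsilon)$ is drawn once for each $l$, and $l\le\Delta_j$, then give $c$ as $l$-th input to the histogram mechanism, set $s$ to its output plus $b$, $\mathrm{out}=\max_i s_i$, $c\leftarrow0$, $l\leftarrow l+1$. Output $\mathrm{out}$. *Histogram mechanism.* It runs one binary tree mechanism per column for stream length $n=\lfloor\Delta_j\rfloor$ with privacy parameter $\epsilon/(2d)$ each (so $\epsilon/2$ in total). Every dyadic interval $((k-1)2^i,k2^i]$ has a noisy partial sum, namely the sum of the inputs in the interval plus one $\mathrm{Lap}(\tfrac{2d(\lfloor\log n\rfloor+1)}{\epsilon})$ variable; after $m$ inputs the output is the sum of the noisy partial sums over the decomposition of $[1,m]$ into dyadic intervals given by the binary digits of $m$. **Statement.** There are an absolute constant $C>0$ and an absolute exponent $k\in\mathbb N$ such that, for all $d,T,\epsilon,\beta,x$ as above and with $$\alpha=C\Bigl(1+\log\log\frac{dTc_{\max}}{\epsilon\beta}\Bigr)^{k}\,\epsilon^{-1}\Bigl(d\log\tfrac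 d\beta\,\log^2\tfrac{d\,c_{\max}}{\epsilon}+\log\tfrac{T}{\epsilon\beta}\Bigr)$$ (that is, $\alpha=O_{\log\log}(\epsilon^{-1}(d\log(d/\beta)\log^2(dc_{\max}/\epsilon)+\log(T/\epsilon\beta)))$, where $O_{\log\log}$ hides a constant and a power of $\log\log$ of $d,T,c_{\max},1/\epsilon,1/\beta$): 1. With the choice $L_j=j$ and $\beta_{\mathrm{in}}=\beta/(3\log T)$, which uses no bound on $c_{\max}$, the two-level mechanism is $(\alpha,2\beta)$-accurate for $\textsc{MaxSum}$ on $x$; moreover, its output at each time $t$ depends on the stream only through $x^1,\dots,x^t$. 2. With the choice $L_j=L:=\log c_{\max}+4\log d+5\log\log T+2\log(12/\epsilon)+2\log\log(1/\beta)$ for all $j$ and $\beta_{\mathrm{in}}=\beta/(3L)$, the two-level mechanism is also $(\alpha,2\beta)$-accurate for $\textsc{MaxSum}$ on $x$. -/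

import Mathlib

open MeasureTheory

namespace TwoLevel

noncomputable section

/-- `log` denotes the binary logarithm. -/
def lg (y : ℝ) : ℝ := Real.logb 2 y

/-! ### Laplace noise -/

/-- The Laplace distribution centred at `0` with scale `b`. -/
def laplaceLaw (b : ℝ) : Measure ℝ :=
  volume.withDensity fun y => ENNReal.ofReal (1 / (2 * b) * Real.exp (-|y| / b))

instance isProbabilityMeasure_laplaceLaw_one : IsProbabilityMeasure (laplaceLaw 1) := by
  constructor
  have hf : ∫ y : ℝ, Real.exp (-|y|) = 2 := by
    have h := integral_comp_abs (f := fun y : ℝ => Real.exp (-y))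
    rw [h, integral_exp_neg_Ioi_zero, mul_one]
  have hi : Integrable (fun y : ℝ => Real.exp (-|y|)) := by
    by_contra hc
    rw [integral_undef hc] at hf
    norm_num at hf
  have h1 : ∫ y : ℝ, 1 / (2 * (1 : ℝ)) * Real.exp (-|y| / 1) = 1 := by
    simp only [div_one, mul_one]
    rw [integral_const_mul, hf]
    norm_num
  rw [laplaceLaw, withDensity_apply _ MeasurableSet.univ, Measure.restrict_univ,
    ← ofReal_integral_eq_lintegral_ofReal, h1, ENNReal.ofReal_one]
  · simpa using hi.const_mul (1 / 2)
  · filter_upwards with y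
    positivity

/-- Names of the independent noise variables used by the two-level mechanism. `seg` is the number of
a segment (the segments, and the instances of the inner mechanism, are numbered from `1`). -/
inductive NoiseIdx (d : ℕ) : Type
  /-- noise of the threshold of segment `seg` -/
  | segThreshold (seg : ℕ)
  /-- noise of the comparison of the outer level at time `t` -/
  | segTest (t : ℕ)
  /-- noise added to column `i` at the end of segment `seg` -/
  | segHist (seg : ℕ) (i : Fin d)
  /-- noise of the `iv`-th threshold of the inner mechanism of segment `seg` -/
  | innerThreshold (seg iv : ℕ)
  /-- noise of the comparison of the inner mechanism that runs at time `t` -/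
  | innerTest (t : ℕ)
  /-- noise of the dyadic interval `((k - 1) 2 ^ level, k 2 ^ level]` in the binary tree that the
  inner mechanism of segment `seg` keeps for column `i` -/
  | tree (seg : ℕ) (i : Fin d) (level k : ℕ)

/-- The joint law of all noise variables: independent, each with law `Lap(1)`. A draw from `Lap(b)`
is obtained as `b` times such a variable. -/
def noiseLaw (d : ℕ) : Measure (NoiseIdx d → ℝ) :=
  Measure.infinitePi fun _ => laplaceLaw 1

/-! ### Streams, `MaxSum`, accuracy

The rows of a stream `x` are `x 1, x 2, …, x T ∈ {0,1}^d`; no other row is ever used. -/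

/-- The entry `0` or `1` as a real number. -/
def entry {d : ℕ} (x : ℕ → Fin d → Bool) (t : ℕ) (i : Fin d) : ℝ := if x t i then 1 else 0

/-- The column sum of column `i` at time `t`. -/
def colSum {d : ℕ} (x : ℕ → Fin d → Bool) (t : ℕ) (i : Fin d) : ℝ :=
  ∑ t' ∈ Finset.Icc 1 t, entry x t' i

/-- The maximum of a vector (a maximum over a finite nonempty index set as soon as `1 ≤ d`). -/
def vmax {d : ℕ} (v : Fin d → ℝ) : ℝ := ⨆ i, v i

/-- The maximum column sum at time `t`. -/
def maxSum {d : ℕ} (x : ℕ → Fin d → Bool) (t : ℕ) : ℝ := vmax (colSum x t)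

/-- The maximum column sum of the whole stream; the all-zero stream is given the value `1`, so that
the logarithm makes sense. -/
def cMax {d : ℕ} (x : ℕ → Fin d → Bool) (T : ℕ) : ℝ := max 1 (maxSum x T)

/-- The largest error `max_{t ∈ [T]} |q^t - a^t|` of answers `a` to a query with values `q`. -/
def maxError (T : ℕ) (q a : ℕ → ℝ) : ℝ := ⨆ t : Fin T, |q (t + 1) - a (t + 1)|

/-- `(α, β)`-accuracy of the randomised answers `A`, whose internal randomness has law `P`:
the largest error exceeds `α` with probability less than `β`. -/
def IsAccurate {Ω : Type*} [MeasurableSpace Ω] (P : Measure Ω) (T : ℕ) (q : ℕ → ℝ)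
    (A : Ω → ℕ → ℝ) (α β : ℝ) : Prop :=
  P {ω | α < maxError T q (A ω)} < ENNReal.ofReal β

/-! ### The binary-tree histogram mechanism -/

/-- The noisy partial sum over the dyadic interval `((k - 1) 2 ^ level, k 2 ^ level]` of a stream `z`
of numbers. -/
def partialSum (z : ℕ → ℝ) (noise : ℕ → ℕ → ℝ) (level k : ℕ) : ℝ :=
  (∑ m ∈ Finset.Ioc ((k - 1) * 2 ^ level) (k * 2 ^ level), z m) + noise level k

/-- The output of the binary tree mechanism after `m` inputs `z 1, …, z m`: the sum of the noisy
partial sums over the dyadic decomposition of `[1, m]` given by the binary digits of `m`. -/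
def treeOutput (z : ℕ → ℝ) (noise : ℕ → ℕ → ℝ) (m : ℕ) : ℝ :=
  ∑ level ∈ (Finset.range m.size).filter (fun level => m.testBit level = true),
    partialSum z noise level (m / 2 ^ level)

/-- The scale of the noise of each partial sum when `d` binary trees for streams of length at most
`n` are run in parallel, with privacy parameter `ε₀ / d` each. -/
def treeScale (d : ℕ) (ε₀ : ℝ) (n : ℕ) : ℝ := (Nat.log 2 n + 1) / (ε₀ / d)

/-- The error bound, for all outputs with failure probability `β / 3`, of the histogram mechanism
consisting of `d` binary trees, with privacy parameter `ε₀` and for stream length `n`. -/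
def treeErr (d : ℕ) (ε₀ β n : ℝ) : ℝ := 4 * ε₀⁻¹ * d * lg n * lg (6 * d * n / β)

/-! ### The two-level mechanism -/

/-- Parameters of the two-level mechanism: stream length bound `T`, privacy parameter `ε`, failure
probability `β`, the value `L j` used in segment `j` as a bound for the number of segments, and the
failure probability `βIn` handed to each instance of the inner mechanism. -/
structure Params where
  T : ℕ
  ε : ℝ
  β : ℝ
  L : ℕ → ℝ
  βIn : ℝ

/-- `α_Γ`: bound for the error of the noisy histogram at the start of segment `j`. -/
def alphaGamma (d : ℕ) (P : Params) (j : ℕ) : ℝ :=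
  4 * √2 / P.ε * d * √(P.L j) * lg (3 * d * lg P.T / P.β)

/-- `α_DM`. -/
def alphaDM (d : ℕ) (P : Params) (j : ℕ) : ℝ :=
  12 / P.ε * lg (3 * P.T / P.β) + alphaGamma d P j + P.L j

/-- `Δ`: bound for the increase of the maximum column sum within segment `j`. -/
def incr (d : ℕ) (P : Params) (j : ℕ) : ℝ := 2 ^ (j - 1) + 2 * alphaDM d P j

/-- `K`: the distance of consecutive thresholds of the inner mechanism of segment `j`. Its histogram
mechanism has privacy parameter `ε / 2`. -/
def innerGap (d : ℕ) (P : Params) (j : ℕ) : ℝ :=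
  3 * (alphaGamma d P j + treeErr d (P.ε / 2) P.βIn (incr d P j)
    + 8 / P.ε * lg (3 * P.T / P.βIn) + 4 / P.ε * lg (3 * incr d P j / P.βIn))

/-- State of an instance of the inner mechanism (modified bounded MaxSum). -/
structure InnerState (d : ℕ) where
  /-- the noisy column sums with which the instance was initialised -/
  base : Fin d → ℝ
  /-- the current interval `j ≥ 1` -/
  iv : ℕ
  /-- the column counts of the current interval -/
  c : Fin d → ℝ
  /-- the noisy column sums -/
  s : Fin d → ℝ
  /-- `fed m` is the `m`-th input of the histogram mechanism, for `1 ≤ m < iv` -/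
  fed : ℕ → Fin d → ℝ
  /-- the current output -/
  out : ℝ

/-- A new instance of the inner mechanism with initial noisy column sums `s`. -/
def InnerState.init {d : ℕ} (s : Fin d → ℝ) : InnerState d where
  base := s
  iv := 1
  c := 0
  s := s
  fed := 0
  out := vmax s

/-- Output of the histogram mechanism (one binary tree per column, for stream length `⌊Δ⌋`) of the
inner mechanism of segment `seg` after the `m` inputs `fed 1, …, fed m`. -/
def histOutput {d : ℕ} (P : Params) (ω : NoiseIdx d → ℝ) (seg : ℕ) (fed : ℕ → Fin d → ℝ) (m : ℕ) :
    Fin d → ℝ := fun i =>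
  treeOutput (fun m' => fed m' i)
    (fun level k => treeScale d (P.ε / 2) ⌊incr d P seg⌋₊ * ω (.tree seg i level k)) m

open Classical in
/-- The instance of the inner mechanism of segment `seg` processes the row `r` at time `t`. The
`j`-th threshold is `max_i base_i + j K`. -/
def InnerState.step {d : ℕ} (P : Params) (ω : NoiseIdx d → ℝ) (seg t : ℕ) (r : Fin d → ℝ)
    (σ : InnerState d) : InnerState d :=
  let c := σ.c + r
  let s := σ.s + r
  if vmax s + 8 / P.ε * ω (.innerTest t)
        > vmax σ.base + σ.iv * innerGap d P seg + 4 / P.ε * ω (.innerThreshold seg σ.iv)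
      ∧ (σ.iv : ℝ) ≤ incr d P seg then
    let fed := Function.update σ.fed σ.iv c
    let s' := histOutput P ω seg fed σ.iv + σ.base
    { base := σ.base, iv := σ.iv + 1, c := 0, s := s', fed := fed, out := vmax s' }
  else
    { σ with c := c, s := s }

/-- State of the two-level mechanism. -/
structure State (d : ℕ) where
  /-- the current segment `j ≥ 1` -/
  seg : ℕ
  /-- the noisy column sums of the outer level -/
  s : Fin d → ℝ
  /-- the current instance of the inner mechanism -/
  inner : InnerState d
  /-- the latest output -/
  out : ℝ

/-- The initial state. -/
def State.init (d : ℕ) : State d where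
  seg := 1
  s := 0
  inner := InnerState.init 0
  out := 0

open Classical in
/-- The two-level mechanism processes the row `r` at time `t`. The threshold of segment `j` is
`2 ^ (j - 1)`. -/
def State.step {d : ℕ} (P : Params) (ω : NoiseIdx d → ℝ) (t : ℕ) (r : Fin d → ℝ) (σ : State d) :
    State d :=
  let s := σ.s + r
  if vmax s + 8 / P.ε * ω (.segTest t)
        > 2 ^ (σ.seg - 1) + 4 / P.ε * ω (.segThreshold σ.seg)
      ∧ (σ.seg : ℝ) < lg P.T then
    let s' : Fin d → ℝ := fun i => s i + 2 * d / P.ε * ω (.segHist σ.seg i)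
    { seg := σ.seg + 1, s := s', inner := InnerState.init s', out := vmax s' }
  else
    let inner := σ.inner.step P ω σ.seg t r
    { seg := σ.seg, s := s, inner := inner, out := inner.out }

/-- The state of the two-level mechanism after the rows `x 1, …, x t`. -/
def stateAt {d : ℕ} (P : Params) (x : ℕ → Fin d → Bool) (ω : NoiseIdx d → ℝ) : ℕ → State d
  | 0 => State.init d
  | t + 1 => (stateAt P x ω t).step P ω (t + 1) (entry x (t + 1))

/-- The output of the two-level mechanism at time `t`. -/
def mechanism {d : ℕ} (P : Params) (x : ℕ → Fin d → Bool) (ω : NoiseIdx d → ℝ) (t : ℕ) : ℝ :=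
  (stateAt P x ω t).out

/-! ### The two choices of `L` -/

/-- No knowledge of `c_max`: in segment `j` the number of segments so far, `j`, is used for `L`, and
each inner instance gets failure probability `β / (3 log T)`. -/
def onlineParams (T : ℕ) (ε β : ℝ) : Params where
  T := T
  ε := ε
  β := β
  L := fun j => j
  βIn := β / (3 * lg T)

/-- The segment bound `L` in terms of the maximum column sum `c`. -/
def segBound (d T : ℕ) (ε β c : ℝ) : ℝ :=
  lg c + 4 * lg d + 5 * lg (lg T) + 2 * lg (12 / ε) + 2 * lg (lg (1 / β))

/-- `L` is the fixed segment bound for the maximum column sum `c`, and each inner instance gets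
failure probability `β / (3 L)`. -/
def fixedParams (d T : ℕ) (ε β c : ℝ) : Params where
  T := T
  ε := ε
  β := β
  L := fun _ => segBound d T ε β c
  βIn := β / (3 * segBound d T ε β c)

/-- The error bound `C (1 + log log (d T c / (ε β)))^k · ε⁻¹ (d log (d/β) log² (d c/ε) + log (T/(ε β)))`:
`O_loglog` hides a constant and a power of the iterated logarithms of `d, T, c, 1/ε, 1/β`. -/
def errBound (C : ℝ) (k d T : ℕ) (ε β c : ℝ) : ℝ :=
  C * (1 + lg (lg (d * T * c / (ε * β)))) ^ k
    * (ε⁻¹ * (d * lg (d / β) * lg (d * c / ε) ^ 2 + lg (T / (ε * β))))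

end

end TwoLevel

/-! The proof separates probability from dynamics. On the event `Quiet`, all noise that can matter
lies within its tail bound, and the run is followed deterministically by induction on time with the
invariant `Tracks` (`exists_tracks`). The outer sums are true column sums plus accumulated noise of
size at most `alphaGamma`. The inner histogram is exact up to `alphaGamma + treeErr`, at most a
third of the gap K. Each inner comparison errs by at most 2K/3, so the interval number pins the
growth of the maximum to within a constant multiple of K, and every output is within 3K of the truth
(`Tracks.abs_out_sub_le`). The cap of Δ intervals never binds: within a segment the maximum stays
below 2Δ, because the outer test did not fire or because T itself is that small, while K ≥ 3.

The event fails with probability below 2β (`noiseLaw_not_quiet_lt`), by a union bound over six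
families. Single variables use the Laplace tail; the accumulated segment noise and the tree noise
use Chernoff's bound.

It remains to bound K in the segments that can occur. A segment ends only if 2^(j-1) is at most
`c_max` plus noise bounds, so Δ in a reachable segment is at most a constant times (d c/ε) Q², where
Q is the logarithm of all the data (`Suitable.incr_le`). Thus log Δ, and with it L, is O(log(d c/ε)
+ log log), which turns K into the claimed bound (`Suitable.innerGap_le`). Both choices of L satisfy
the conditions `Suitable`. For the fixed choice this rests on `segBound_capacity`: 2^L is at least
twice the largest value at which a segment can end. If β > 1/2 there is nothing to prove, since 2β >
1. -/

namespace TwoLevel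

open ProbabilityTheory

/-! ### Tail bounds for Laplace noise -/

theorem laplaceLaw_one_eq :
    laplaceLaw 1 = volume.withDensity fun y : ℝ => ENNReal.ofReal (1 / 2 * Real.exp (-|y|)) := by
  simp [laplaceLaw]

theorem laplaceLaw_Ioi {s : ℝ} (hs : 0 ≤ s) :
    laplaceLaw 1 (Set.Ioi s) = ENNReal.ofReal (1 / 2 * Real.exp (-s)) := by
  rw [laplaceLaw_one_eq, withDensity_apply _ measurableSet_Ioi,
    ← integral_exp_neg_Ioi s, ← integral_const_mul, ofReal_integral_eq_lintegral_ofReal]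
  · refine setLIntegral_congr_fun measurableSet_Ioi fun y hy => ?_
    simp only [abs_of_pos (lt_of_le_of_lt hs hy)]
  · exact (integrableOn_exp_neg_Ioi s).const_mul _
  · filter_upwards with y
    positivity

theorem laplaceLaw_Iic {s : ℝ} (hs : 0 ≤ s) :
    laplaceLaw 1 (Set.Iic (-s)) = ENNReal.ofReal (1 / 2 * Real.exp (-s)) := by
  rw [laplaceLaw_one_eq, withDensity_apply _ measurableSet_Iic,
    ← integral_exp_Iic (-s), ← integral_const_mul, ofReal_integral_eq_lintegral_ofReal]
  · refine setLIntegral_congr_fun measurableSet_Iic fun y hy => ?_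
    have h : y ≤ 0 := le_trans hy (by linarith)
    simp only [abs_of_nonpos h, neg_neg]
  · exact (integrableOn_exp_Iic (-s)).const_mul _
  · filter_upwards with y
    positivity

theorem laplaceLaw_abs_gt {s : ℝ} (hs : 0 ≤ s) :
    laplaceLaw 1 {y | s < |y|} ≤ ENNReal.ofReal (Real.exp (-s)) := by
  have h : {y : ℝ | s < |y|} ⊆ Set.Ioi s ∪ Set.Iic (-s) := by
    intro y hy
    rcases lt_abs.1 (Set.mem_ofPred_eq ▸ hy) with h | h
    · exact Or.inl h
    · exact Or.inr (by simp only [Set.mem_Iic]; linarith)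
  refine (measure_mono h).trans ((measure_union_le _ _).trans ?_)
  rw [laplaceLaw_Ioi hs, laplaceLaw_Iic hs, ← ENNReal.ofReal_add (by positivity) (by positivity)]
  apply ENNReal.ofReal_le_ofReal
  linarith

/-- On each half-line |y| is linear, so the integrand is a pure exponential. The two halves add up
to the Laplace moment generating function 1/(1 - u²). -/
theorem integrableOn_exp_mul_neg_abs {u : ℝ} (h1 : -1 < u) (h2 : u < 1) :
    IntegrableOn (fun y : ℝ => Real.exp (u * y - |y|)) (Set.Iic 0) ∧
    IntegrableOn (fun y : ℝ => Real.exp (u * y - |y|)) (Set.Ioi 0) ∧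
    ∫ y : ℝ in Set.Iic 0, Real.exp (u * y - |y|) = 1 / (1 + u) ∧
    ∫ y : ℝ in Set.Ioi 0, Real.exp (u * y - |y|) = 1 / (1 - u) := by
  have e1 : Set.EqOn (fun y : ℝ => Real.exp ((1 + u) * y))
      (fun y : ℝ => Real.exp (u * y - |y|)) (Set.Iic 0) := by
    intro y hy
    simp only [abs_of_nonpos (Set.mem_Iic.1 hy)]
    ring_nf
  have e2 : Set.EqOn (fun y : ℝ => Real.exp ((u - 1) * y))
      (fun y : ℝ => Real.exp (u * y - |y|)) (Set.Ioi 0) := by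
    intro y hy
    simp only [abs_of_pos (Set.mem_Ioi.1 hy)]
    ring_nf
  refine ⟨(integrableOn_exp_mul_Iic (by linarith) 0).congr_fun e1 measurableSet_Iic,
    (integrableOn_exp_mul_Ioi (by linarith) 0).congr_fun e2 measurableSet_Ioi, ?_, ?_⟩
  · rw [← setIntegral_congr_fun measurableSet_Iic e1, integral_exp_mul_Iic (by linarith)]
    simp
  · rw [← setIntegral_congr_fun measurableSet_Ioi e2, integral_exp_mul_Ioi (by linarith)]
    have : u - 1 ≠ 0 := by linarith
    have : 1 - u ≠ 0 := by linarith
    simp only [mul_zero, Real.exp_zero]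
    rw [div_eq_div_iff (by assumption) (by assumption)]
    ring

theorem integrable_exp_mul_neg_abs {u : ℝ} (h1 : -1 < u) (h2 : u < 1) :
    Integrable (fun y : ℝ => Real.exp (u * y - |y|)) := by
  obtain ⟨i1, i2, -, -⟩ := integrableOn_exp_mul_neg_abs h1 h2
  rw [← integrableOn_univ, ← Set.Iic_union_Ioi (a := (0 : ℝ))]
  exact i1.union i2

theorem laplace_smul_eq (u y : ℝ) :
    (ENNReal.ofReal (1 / 2 * Real.exp (-|y|))).toReal • Real.exp (u * y)
      = 1 / 2 * Real.exp (u * y - |y|) := by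
  rw [ENNReal.toReal_ofReal (by positivity), smul_eq_mul, sub_eq_add_neg, Real.exp_add]
  ring

theorem integrable_exp_mul_laplaceLaw {u : ℝ} (h1 : -1 < u) (h2 : u < 1) :
    Integrable (fun y : ℝ => Real.exp (u * y)) (laplaceLaw 1) := by
  rw [laplaceLaw_one_eq, integrable_withDensity_iff_integrable_smul' (by fun_prop)
      (.of_forall fun _ => ENNReal.ofReal_lt_top)]
  simp_rw [laplace_smul_eq]
  exact (integrable_exp_mul_neg_abs h1 h2).const_mul _

theorem integral_exp_mul_laplaceLaw {u : ℝ} (h1 : -1 < u) (h2 : u < 1) :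
    ∫ y, Real.exp (u * y) ∂(laplaceLaw 1) = (1 - u ^ 2)⁻¹ := by
  obtain ⟨i1, i2, h3, h4⟩ := integrableOn_exp_mul_neg_abs h1 h2
  rw [laplaceLaw_one_eq, integral_withDensity_eq_integral_toReal_smul (by fun_prop)
      (.of_forall fun _ => ENNReal.ofReal_lt_top)]
  simp_rw [laplace_smul_eq]
  rw [integral_const_mul, ← setIntegral_univ, ← Set.Iic_union_Ioi (a := (0 : ℝ)),
    setIntegral_union (Set.Iic_disjoint_Ioi le_rfl) measurableSet_Ioi i1 i2, h3, h4]
  have : 1 - u ≠ 0 := by linarith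
  have : 1 + u ≠ 0 := by linarith
  have : 1 - u ^ 2 ≠ 0 := by
    have : 1 - u ^ 2 = (1 - u) * (1 + u) := by ring
    rw [this]
    positivity
  field_simp
  ring

section

variable {d : ℕ}

instance isProbabilityMeasure_noiseLaw : IsProbabilityMeasure (noiseLaw d) := by
  unfold noiseLaw
  infer_instance

theorem noiseLaw_abs_gt (a : NoiseIdx d) {s : ℝ} (hs : 0 ≤ s) :
    noiseLaw d {ω | s < |ω a|} ≤ ENNReal.ofReal (Real.exp (-s)) := by
  have h := (measurePreserving_eval_infinitePi
    (fun _ : NoiseIdx d => laplaceLaw 1) a).measure_preimage (s := {y | s < |y|}) (measurableSet_lt measurable_const (by fun_prop)).nullMeasurableSet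
  exact h.trans_le (laplaceLaw_abs_gt hs)

theorem integrable_exp_mul_and_mgf_noise (a : NoiseIdx d) {u : ℝ} (h1 : -1 < u) (h2 : u < 1) :
    Integrable (fun ω : NoiseIdx d → ℝ => Real.exp (u * ω a)) (noiseLaw d) ∧
    mgf (fun ω : NoiseIdx d → ℝ => ω a) (noiseLaw d) u = (1 - u ^ 2)⁻¹ := by
  have h := measurePreserving_eval_infinitePi (fun _ : NoiseIdx d => laplaceLaw 1) a
  constructor
  · exact h.integrable_comp_of_integrable (integrable_exp_mul_laplaceLaw h1 h2)
  · rw [← integral_exp_mul_laplaceLaw h1 h2, ← h.map_eq,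
      integral_map h.measurable.aemeasurable (by fun_prop)]
    rfl

/-- By independence the moment generating functions multiply; this is the input to Chernoff's bound.
-/
theorem integrable_exp_mul_and_mgf_noise_sum (S : Finset (NoiseIdx d)) {u : ℝ}
    (h1 : -1 < u) (h2 : u < 1) :
    Integrable (fun ω : NoiseIdx d → ℝ => Real.exp (u * ∑ a ∈ S, ω a)) (noiseLaw d) ∧
    mgf (fun ω : NoiseIdx d → ℝ => ∑ a ∈ S, ω a) (noiseLaw d) u = ((1 - u ^ 2)⁻¹) ^ S.card := by
  have hi : iIndepFun (fun (a : NoiseIdx d) (ω : NoiseIdx d → ℝ) => ω a) (noiseLaw d) :=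
    iIndepFun_infinitePi (X := fun _ y => y) (fun _ => measurable_id)
  have hm : ∀ a : NoiseIdx d, Measurable (fun ω : NoiseIdx d → ℝ => ω a) := measurable_pi_apply
  constructor
  · have := hi.integrable_exp_mul_sum hm (t := u) (s := S)
      fun a _ => (integrable_exp_mul_and_mgf_noise a h1 h2).1
    simpa [Finset.sum_apply] using this
  · have := hi.mgf_sum hm (t := u) S
    rw [Finset.prod_congr rfl fun a _ => (integrable_exp_mul_and_mgf_noise a h1 h2).2,
      Finset.prod_const] at this
    rw [← this]
    congr 1
    ext ω
    simp

/-- Chernoff's bound for a sum of independent Laplace variables. -/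
theorem noiseLaw_abs_sum_gt (S : Finset (NoiseIdx d)) {u s : ℝ} (h1 : 0 ≤ u) (h2 : u < 1) :
    noiseLaw d {ω | s < |∑ a ∈ S, ω a|}
      ≤ ENNReal.ofReal (2 * (Real.exp (-u * s) * ((1 - u ^ 2)⁻¹) ^ S.card)) := by
  obtain ⟨i1, m1⟩ := integrable_exp_mul_and_mgf_noise_sum S (u := u) (by linarith) h2
  obtain ⟨i2, m2⟩ := integrable_exp_mul_and_mgf_noise_sum S (u := -u) (by linarith) (by linarith)
  have c1 := measure_ge_le_exp_mul_mgf s h1 i1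
  have c2 := measure_le_le_exp_mul_mgf (-s) (by linarith : -u ≤ 0) i2
  rw [m1] at c1
  rw [m2] at c2
  have h : {ω : NoiseIdx d → ℝ | s < |∑ a ∈ S, ω a|}
      ⊆ {ω | s ≤ ∑ a ∈ S, ω a} ∪ {ω | ∑ a ∈ S, ω a ≤ -s} := by
    intro ω hω
    rcases lt_abs.1 (Set.mem_ofPred_eq ▸ hω) with h | h
    · exact Or.inl h.le
    · exact Or.inr (by simp only [Set.mem_ofPred_eq]; linarith)
  refine (measure_mono h).trans ?_
  rw [← ofReal_measureReal]
  apply ENNReal.ofReal_le_ofReal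
  refine (measureReal_union_le _ _).trans ?_
  have e : -(-u) * -s = -u * s := by ring
  rw [e, neg_sq] at c2
  linarith

end

/-! ### The binary tree mechanism -/

/-- Clearing the binary digits of m below position l, or below l + 1, gives numbers that differ
exactly by digit l. -/
theorem div_two_pow_mul_split (m l : ℕ) :
    m / 2 ^ l * 2 ^ l = m / 2 ^ (l + 1) * 2 ^ (l + 1) + if m.testBit l then 2 ^ l else 0 := by
  have h1 : m / 2 ^ (l + 1) = m / 2 ^ l / 2 := by rw [pow_succ, Nat.div_div_eq_div_mul]
  have h2 : m.testBit l = decide (m / 2 ^ l % 2 = 1) := Nat.testBit_eq_decide_div_mod_eq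
  have h3 := Nat.div_add_mod (m / 2 ^ l) 2
  rw [h1, pow_succ, h2]
  generalize m / 2 ^ l = q at *
  rcases Nat.mod_two_eq_zero_or_one q with h | h
  · simp only [h, zero_ne_one, decide_false, Bool.false_eq_true, if_false, add_zero]
    rw [h, add_zero] at h3
    conv_lhs => rw [← h3]
    ring
  · simp only [h, decide_true, if_true]
    rw [h] at h3
    conv_lhs => rw [← h3]
    ring

/-- The dyadic intervals given by the binary digits of `m` partition `[1, m]`. -/
theorem sum_dyadic_eq (z : ℕ → ℝ) (m : ℕ) :
    ∑ level ∈ (Finset.range m.size).filter (fun level => m.testBit level = true),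
        ∑ k ∈ Finset.Ioc ((m / 2 ^ level - 1) * 2 ^ level) (m / 2 ^ level * 2 ^ level), z k
      = ∑ k ∈ Finset.Ioc 0 m, z k := by
  -- F sums over the prefix that remains after clearing the l lowest digits. The block of level l is
  -- the difference of consecutive prefixes, so the sum telescopes from the full prefix to the empty
  -- one.
  let F : ℕ → ℝ := fun l => ∑ k ∈ Finset.Ioc 0 (m / 2 ^ l * 2 ^ l), z k
  have hF : ∀ l, (if m.testBit l = true then
      ∑ k ∈ Finset.Ioc ((m / 2 ^ l - 1) * 2 ^ l) (m / 2 ^ l * 2 ^ l), z k else 0)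
        = F l - F (l + 1) := by
    intro l
    have h := div_two_pow_mul_split m l
    by_cases hb : m.testBit l = true
    · rw [if_pos hb] at h ⊢
      have h' : (m / 2 ^ l - 1) * 2 ^ l = m / 2 ^ (l + 1) * 2 ^ (l + 1) := by
        rw [Nat.sub_mul, h, one_mul, Nat.add_sub_cancel]
      have hle : m / 2 ^ (l + 1) * 2 ^ (l + 1) ≤ m / 2 ^ l * 2 ^ l := by
        rw [h]
        exact Nat.le_add_right _ _
      simp only [F]
      rw [h', ← Finset.sum_Ioc_consecutive z (Nat.zero_le _) hle]
      ring
    · rw [if_neg hb] at h ⊢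
      simp only [F]
      rw [h, add_zero, sub_self]
  rw [Finset.sum_filter, Finset.sum_congr rfl fun l _ => hF l, Finset.sum_range_sub']
  simp only [F]
  rw [Nat.div_eq_of_lt (Nat.lt_size_self m)]
  simp

theorem treeOutput_eq (z : ℕ → ℝ) (noise : ℕ → ℕ → ℝ) (m : ℕ) :
    treeOutput z noise m = ∑ k ∈ Finset.Ioc 0 m, z k
      + ∑ level ∈ (Finset.range m.size).filter (fun level => m.testBit level = true),
          noise level (m / 2 ^ level) := by
  rw [← sum_dyadic_eq z m, ← Finset.sum_add_distrib]
  rfl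

/-- The sum of the noise variables in the output of a tree after `m` inputs. -/
def treeNoise {d : ℕ} (ω : NoiseIdx d → ℝ) (seg : ℕ) (i : Fin d) (m : ℕ) : ℝ :=
  ∑ level ∈ (Finset.range m.size).filter (fun level => m.testBit level = true),
    ω (.tree seg i level (m / 2 ^ level))

theorem histOutput_eq {d : ℕ} (P : Params) (ω : NoiseIdx d → ℝ) (seg : ℕ)
    (fed : ℕ → Fin d → ℝ) (m : ℕ) (i : Fin d) :
    histOutput P ω seg fed m i = ∑ k ∈ Finset.Ioc 0 m, fed k i
      + treeScale d (P.ε / 2) ⌊incr d P seg⌋₊ * treeNoise ω seg i m := by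
  rw [histOutput, treeOutput_eq, treeNoise, Finset.mul_sum]

/-- Lets the invariant treat a fresh inner instance as the case m = 0, with no separate formula for
its initial output. -/
theorem histOutput_zero {d : ℕ} (P : Params) (ω : NoiseIdx d → ℝ) (seg : ℕ)
    (fed : ℕ → Fin d → ℝ) : histOutput P ω seg fed 0 = 0 := by
  ext i
  simp [histOutput_eq, treeNoise]

/-! ### Maxima and column sums -/

section

variable {d : ℕ}

theorem le_vmax (v : Fin d → ℝ) (i : Fin d) : v i ≤ vmax v :=
  le_ciSup (Set.finite_range v).bddAbove i

theorem vmax_le_add (hd : 1 ≤ d) {u v : Fin d → ℝ} {r : ℝ} (h : ∀ i, |u i - v i| ≤ r) :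
    vmax u ≤ vmax v + r := by
  have : Nonempty (Fin d) := ⟨⟨0, hd⟩⟩
  refine ciSup_le fun i => ?_
  have := (abs_le.1 (h i)).2
  have := le_vmax v i
  linarith

theorem abs_vmax_sub_le (hd : 1 ≤ d) {u v : Fin d → ℝ} {r : ℝ} (h : ∀ i, |u i - v i| ≤ r) :
    |vmax u - vmax v| ≤ r := by
  have h1 := vmax_le_add hd h
  have h2 := vmax_le_add hd (u := v) (v := u) (r := r) fun i => by rw [abs_sub_comm]; exact h i
  rw [abs_le]
  constructor <;> linarith

theorem colSum_zero (x : ℕ → Fin d → Bool) : colSum x 0 = 0 := by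
  ext i
  simp [colSum]

theorem colSum_succ (x : ℕ → Fin d → Bool) (t : ℕ) :
    colSum x (t + 1) = colSum x t + entry x (t + 1) := by
  ext i
  simp [colSum, Finset.sum_Icc_succ_top]

theorem entry_nonneg (x : ℕ → Fin d → Bool) (t : ℕ) (i : Fin d) : 0 ≤ entry x t i := by
  unfold entry
  split_ifs <;> norm_num

theorem entry_le_one (x : ℕ → Fin d → Bool) (t : ℕ) (i : Fin d) : entry x t i ≤ 1 := by
  unfold entry
  split_ifs <;> norm_num

theorem maxSum_mono (hd : 1 ≤ d) (x : ℕ → Fin d → Bool) : Monotone (maxSum x) := by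
  have : Nonempty (Fin d) := ⟨⟨0, hd⟩⟩
  refine monotone_nat_of_le_succ fun t => ciSup_le fun i => ?_
  have h := le_vmax (colSum x (t + 1)) i
  rw [colSum_succ] at h
  have := entry_nonneg x (t + 1) i
  simp only [Pi.add_apply] at h
  rw [maxSum, colSum_succ]
  linarith

theorem maxSum_zero (x : ℕ → Fin d → Bool) : maxSum x 0 = 0 := by
  simp [maxSum, colSum_zero, vmax]

theorem maxSum_nonneg (hd : 1 ≤ d) (x : ℕ → Fin d → Bool) (t : ℕ) : 0 ≤ maxSum x t := by
  rw [← maxSum_zero x]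
  exact maxSum_mono hd x (Nat.zero_le t)

theorem maxSum_le (hd : 1 ≤ d) (x : ℕ → Fin d → Bool) (t : ℕ) : maxSum x t ≤ t := by
  have : Nonempty (Fin d) := ⟨⟨0, hd⟩⟩
  refine ciSup_le fun i => ?_
  calc colSum x t i ≤ ∑ _t' ∈ Finset.Icc 1 t, (1 : ℝ) :=
        Finset.sum_le_sum fun t' _ => entry_le_one x t' i
    _ = t := by simp

theorem maxError_le {T : ℕ} (hT : 1 ≤ T) {q a : ℕ → ℝ} {α : ℝ}
    (h : ∀ t, t ≤ T → |q t - a t| ≤ α) : maxError T q a ≤ α := by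
  have : Nonempty (Fin T) := ⟨⟨0, hT⟩⟩
  exact ciSup_le fun t => h (t + 1) t.2

/-! ### The output does not depend on future rows -/

/-- A step reads only the current row and the state, so induction on time suffices. -/
theorem stateAt_congr (P : Params) {x y : ℕ → Fin d → Bool} (ω : NoiseIdx d → ℝ) {t : ℕ}
    (h : ∀ t', 1 ≤ t' → t' ≤ t → x t' = y t') : stateAt P x ω t = stateAt P y ω t := by
  induction t with
  | zero => rfl
  | succ t ih =>
    have e : entry x (t + 1) = entry y (t + 1) := by
      ext i
      simp [entry, h (t + 1) (by omega) le_rfl]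
    rw [stateAt, stateAt, ih fun t' h1 h2 => h t' h1 (by omega), e]

end

/-! ### Analysis of the mechanism when all noise is small -/

/-- Bound for the total noise in a comparison of the outer level. -/
noncomputable def outerSlack (P : Params) : ℝ := 12 / P.ε * lg (3 * P.T / P.β)

/-- The total noise added to column `i` at the ends of the segments before `seg`. -/
noncomputable def histNoise {d : ℕ} (P : Params) (ω : NoiseIdx d → ℝ) (seg : ℕ) (i : Fin d) : ℝ :=
  2 * d / P.ε * ∑ j ∈ Finset.Ico 1 seg, ω (.segHist j i)

/-- Segment `i` may end if the maximum column sum of the whole stream is at most `c`. -/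
def MayEnd (d : ℕ) (P : Params) (c : ℝ) (i : ℕ) : Prop :=
  (i : ℝ) < lg P.T ∧ 2 ^ (i - 1) ≤ c + alphaGamma d P i + outerSlack P

/-- Segment `j` may occur if the maximum column sum of the whole stream is at most `c`. -/
def Reachable (d : ℕ) (P : Params) (c : ℝ) (j : ℕ) : Prop :=
  j = 1 ∨ ∃ i, j = i + 1 ∧ 1 ≤ i ∧ MayEnd d P c i

/-- Conditions on the parameters under which the mechanism is accurate as long as the noise is
small; `J` bounds the number of segments on streams with maximum column sum at most `c`. -/
structure Regular (d : ℕ) (P : Params) (J : ℕ) (c : ℝ) : Prop where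
  one_le_d : 1 ≤ d
  one_le_T : 1 ≤ P.T
  ε_pos : 0 < P.ε
  one_le_J : 1 ≤ J
  gamma_nonneg : ∀ j, 1 ≤ j → j ≤ J → 0 ≤ alphaGamma d P j
  treeErr_nonneg : ∀ j, 1 ≤ j → j ≤ J → 0 ≤ treeErr d (P.ε / 2) P.βIn (incr d P j)
  test_nonneg : 0 ≤ lg (3 * P.T / P.βIn)
  threshold_nonneg : ∀ j, 1 ≤ j → j ≤ J → 0 ≤ lg (3 * incr d P j / P.βIn)
  three_le_gap : ∀ j, 1 ≤ j → j ≤ J → 3 ≤ innerGap d P j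
  five_le_incr : ∀ j, 1 ≤ j → j ≤ J → 5 ≤ incr d P j
  le_incr : ∀ j, 1 ≤ j → j ≤ J → 2 ^ (j - 1) + alphaGamma d P j + outerSlack P ≤ incr d P j
  succ_le : ∀ j, 1 ≤ j → j ≤ J → MayEnd d P c j → j + 1 ≤ J

/-- All noise variables used in the first `J` segments and up to time `T` are small. -/
structure Quiet {d : ℕ} (P : Params) (J : ℕ) (ω : NoiseIdx d → ℝ) : Prop where
  segTest : ∀ t, 1 ≤ t → t ≤ P.T → |ω (.segTest t)| ≤ lg (3 * P.T / P.β)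
  segThreshold : ∀ j, 1 ≤ j → j ≤ J → |ω (.segThreshold j)| ≤ lg (3 * P.T / P.β)
  hist : ∀ j, 1 ≤ j → j ≤ J → ∀ i, |histNoise P ω j i| ≤ alphaGamma d P j
  innerTest : ∀ t, 1 ≤ t → t ≤ P.T → |ω (.innerTest t)| ≤ lg (3 * P.T / P.βIn)
  innerThreshold : ∀ j, 1 ≤ j → j ≤ J → ∀ l : ℕ, 1 ≤ l → (l : ℝ) ≤ incr d P j →
    |ω (.innerThreshold j l)| ≤ lg (3 * incr d P j / P.βIn)
  tree : ∀ j, 1 ≤ j → j ≤ J → ∀ i, ∀ m : ℕ, m ≤ ⌊incr d P j⌋₊ →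
    |treeScale d (P.ε / 2) ⌊incr d P j⌋₊ * treeNoise ω j i m|
      ≤ treeErr d (P.ε / 2) P.βIn (incr d P j)

/-- The state `σ` at time `t`, where the current segment started at time `t₀`, and the current
interval of the inner mechanism, with number `m + 1`, at time `t₁`. -/
structure Tracks {d : ℕ} (P : Params) (J : ℕ) (x : ℕ → Fin d → Bool) (ω : NoiseIdx d → ℝ)
    (t : ℕ) (σ : State d) (t₀ t₁ m : ℕ) : Prop where
  seg_pos : 1 ≤ σ.seg
  seg_le : σ.seg ≤ J
  reachable : Reachable d P (cMax x P.T) σ.seg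
  sums : ∀ i, σ.s i = colSum x t i + histNoise P ω σ.seg i
  start_le : t₀ ≤ t₁
  le_now : t₁ ≤ t
  base : ∀ i, σ.inner.base i = colSum x t₀ i + histNoise P ω σ.seg i
  iv : σ.inner.iv = m + 1
  m_le : m ≤ ⌊incr d P σ.seg⌋₊
  fed : ∀ i, ∑ k ∈ Finset.Ioc 0 m, σ.inner.fed k i = colSum x t₁ i - colSum x t₀ i
  c : ∀ i, σ.inner.c i = colSum x t i - colSum x t₁ i
  s : ∀ i, σ.inner.s i
    = histOutput P ω σ.seg σ.inner.fed m i + σ.inner.base i + σ.inner.c i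
  out : σ.out = vmax (histOutput P ω σ.seg σ.inner.fed m + σ.inner.base)
  inner_out : σ.inner.out = σ.out
  low : maxSum x t₀ + m * innerGap d P σ.seg - 2 / 3 * innerGap d P σ.seg ≤ maxSum x t₁
  high : t₁ = t ∨ maxSum x t
    ≤ maxSum x t₀ + (m + 1) * innerGap d P σ.seg + 2 / 3 * innerGap d P σ.seg

section

variable {d : ℕ} {P : Params} {J : ℕ} {x : ℕ → Fin d → Bool} {ω : NoiseIdx d → ℝ}

/-- The noise in a comparison of the inner mechanism is at most `2 / 3` of the gap. -/
theorem Regular.slack_le {c : ℝ} (hR : Regular d P J c) {j : ℕ} (h1 : 1 ≤ j) (h2 : j ≤ J) :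
    2 * alphaGamma d P j + treeErr d (P.ε / 2) P.βIn (incr d P j) + 8 / P.ε * lg (3 * P.T / P.βIn)
      + 4 / P.ε * lg (3 * incr d P j / P.βIn) ≤ 2 / 3 * innerGap d P j ∧
    alphaGamma d P j + treeErr d (P.ε / 2) P.βIn (incr d P j) ≤ 1 / 3 * innerGap d P j := by
  have hε := hR.ε_pos
  have a := hR.gamma_nonneg j h1 h2
  have b := hR.treeErr_nonneg j h1 h2
  have c : 0 ≤ 8 / P.ε * lg (3 * P.T / P.βIn) := mul_nonneg (by positivity) hR.test_nonneg
  have e : 0 ≤ 4 / P.ε * lg (3 * incr d P j / P.βIn) :=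
    mul_nonneg (by positivity) (hR.threshold_nonneg j h1 h2)
  unfold innerGap
  constructor <;> linarith

theorem abs_scale_mul_le {ε a w r : ℝ} (hε : 0 < ε) (ha : 0 ≤ a) (h : |w| ≤ r) :
    |a / ε * w| ≤ a / ε * r := by
  rw [abs_mul, abs_of_nonneg (by positivity)]
  gcongr

theorem Tracks.init {c : ℝ} (hR : Regular d P J c) :
    Tracks P J x ω 0 (State.init d) 0 0 0 where
  seg_pos := le_rfl
  seg_le := hR.one_le_J
  reachable := Or.inl rfl
  sums i := by simp [State.init, colSum_zero, histNoise]
  start_le := le_rfl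
  le_now := le_rfl
  base i := by simp [State.init, InnerState.init, colSum_zero, histNoise]
  iv := rfl
  m_le := Nat.zero_le _
  fed i := by simp
  c i := by simp [State.init, InnerState.init]
  s i := by simp [State.init, InnerState.init, histOutput_zero]
  out := by simp [State.init, InnerState.init, histOutput_zero, vmax]
  inner_out := by simp [State.init, InnerState.init, vmax]
  low := by
    have := hR.three_le_gap 1 le_rfl hR.one_le_J
    simp only [State.init, CharP.cast_eq_zero, zero_mul]
    linarith
  high := Or.inl rfl

/-- The error of the histogram kept by the inner mechanism. -/
theorem Tracks.abs_hist_sub_le {t : ℕ} {σ : State d} {t₀ t₁ m : ℕ}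
    (hQ : Quiet P J ω) (h : Tracks P J x ω t σ t₀ t₁ m) (i : Fin d) :
    |histOutput P ω σ.seg σ.inner.fed m i + σ.inner.base i - colSum x t₁ i|
      ≤ alphaGamma d P σ.seg + treeErr d (P.ε / 2) P.βIn (incr d P σ.seg) := by
  have a := hQ.hist _ h.seg_pos h.seg_le i
  have b := hQ.tree _ h.seg_pos h.seg_le i m h.m_le
  rw [histOutput_eq, h.fed, h.base]
  rw [abs_le] at *
  constructor <;> linarith [a.1, a.2, b.1, b.2]

/-- The error of the output. -/
theorem Tracks.abs_out_sub_le {c : ℝ} (hR : Regular d P J c) (hQ : Quiet P J ω) {t : ℕ}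
    {σ : State d} {t₀ t₁ m : ℕ} (h : Tracks P J x ω t σ t₀ t₁ m) :
    |maxSum x t - σ.out| ≤ 3 * innerGap d P σ.seg := by
  have a : |σ.out - maxSum x t₁| ≤ 1 / 3 * innerGap d P σ.seg := by
    rw [h.out]
    exact (abs_vmax_sub_le hR.one_le_d fun i => h.abs_hist_sub_le hQ i).trans
      (hR.slack_le h.seg_pos h.seg_le).2
  have b := maxSum_mono hR.one_le_d x h.le_now
  have k := hR.three_le_gap _ h.seg_pos h.seg_le
  -- Subtracting `low` from `high` leaves one full gap plus twice the slack 2/3. With the histogram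
  -- error 1/3 the total is 8/3 < 3.
  have e : maxSum x t ≤ maxSum x t₁ + 7 / 3 * innerGap d P σ.seg := by
    rcases h.high with e | e
    · rw [e]
      linarith
    · have := h.low
      linarith
  rw [abs_le] at *
  constructor <;> linarith [a.1, a.2]

/-- The end of a segment. -/
theorem Tracks.endSegment (hR : Regular d P J (cMax x P.T)) (hQ : Quiet P J ω) {t : ℕ}
    {σ : State d} {t₀ t₁ m : ℕ} (h : Tracks P J x ω t σ t₀ t₁ m) (ht : t + 1 ≤ P.T)
    (hc : vmax (σ.s + entry x (t + 1)) + 8 / P.ε * ω (.segTest (t + 1))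
        > 2 ^ (σ.seg - 1) + 4 / P.ε * ω (.segThreshold σ.seg))
    (hl : (σ.seg : ℝ) < lg P.T) (s' : Fin d → ℝ)
    (hs : s' = fun i => (σ.s + entry x (t + 1)) i + 2 * d / P.ε * ω (.segHist σ.seg i)) :
    Tracks P J x ω (t + 1)
      { seg := σ.seg + 1, s := s', inner := InnerState.init s', out := vmax s' }
      (t + 1) (t + 1) 0 := by
  have hn : ∀ i, histNoise P ω (σ.seg + 1) i
      = histNoise P ω σ.seg i + 2 * d / P.ε * ω (.segHist σ.seg i) := by
    intro i
    rw [histNoise, Finset.sum_Ico_succ_top h.seg_pos, mul_add]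
    rfl
  have hs' : ∀ i, s' i = colSum x (t + 1) i + histNoise P ω (σ.seg + 1) i := by
    intro i
    rw [hs, hn, colSum_succ]
    simp only [Pi.add_apply, h.sums]
    ring
  -- The test fired, so the threshold is at most the true maximum plus the sum noise and the
  -- comparison noise; the former is bounded by `alphaGamma`, the latter by `outerSlack`.
  have hend : MayEnd d P (cMax x P.T) σ.seg := by
    refine ⟨hl, ?_⟩
    have a := vmax_le_add hR.one_le_d (u := σ.s + entry x (t + 1)) (v := colSum x (t + 1))
      (r := alphaGamma d P σ.seg) fun i => by
        have := hQ.hist _ h.seg_pos h.seg_le i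
        rw [colSum_succ]
        simp only [Pi.add_apply, h.sums]
        convert this using 2
        ring
    have b := (maxSum_mono hR.one_le_d x ht).trans (le_max_right 1 _)
    have c1 := abs_scale_mul_le hR.ε_pos (by norm_num : (0 : ℝ) ≤ 8)
      (hQ.segTest (t + 1) (by omega) ht)
    have c2 := abs_scale_mul_le hR.ε_pos (by norm_num : (0 : ℝ) ≤ 4)
      (hQ.segThreshold _ h.seg_pos h.seg_le)
    have e : outerSlack P = 8 / P.ε * lg (3 * P.T / P.β) + 4 / P.ε * lg (3 * P.T / P.β) := by
      rw [outerSlack]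
      ring
    rw [e]
    unfold maxSum at b
    unfold cMax maxSum
    linarith [(abs_le.1 c1).2, (abs_le.1 c2).1]
  have hle := hR.succ_le _ h.seg_pos h.seg_le hend
  exact
  { seg_pos := by simp
    seg_le := hle
    reachable := Or.inr ⟨_, rfl, h.seg_pos, hend⟩
    sums := hs'
    start_le := le_rfl
    le_now := le_rfl
    base := hs'
    iv := rfl
    m_le := Nat.zero_le _
    fed := by simp
    c := by simp [InnerState.init]
    s := by simp [InnerState.init, histOutput_zero]
    out := by simp [InnerState.init, histOutput_zero]
    inner_out := rfl
    low := by
      have := hR.three_le_gap _ (by omega) hle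
      simp only [CharP.cast_eq_zero, zero_mul]
      linarith
    high := Or.inl rfl }

/-- A row that does not end the segment. -/
theorem Tracks.continueSegment (hR : Regular d P J (cMax x P.T)) (hQ : Quiet P J ω) {t : ℕ}
    {σ : State d} {t₀ t₁ m : ℕ} (h : Tracks P J x ω t σ t₀ t₁ m) (ht : t + 1 ≤ P.T)
    (hc : ¬ (vmax (σ.s + entry x (t + 1)) + 8 / P.ε * ω (.segTest (t + 1))
        > 2 ^ (σ.seg - 1) + 4 / P.ε * ω (.segThreshold σ.seg) ∧ (σ.seg : ℝ) < lg P.T)) :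
    ∃ t₁ m, Tracks P J x ω (t + 1)
      { seg := σ.seg, s := σ.s + entry x (t + 1),
        inner := σ.inner.step P ω σ.seg (t + 1) (entry x (t + 1)),
        out := (σ.inner.step P ω σ.seg (t + 1) (entry x (t + 1))).out } t₀ t₁ m := by
  have hd := hR.one_le_d
  have hslack := hR.slack_le h.seg_pos h.seg_le
  have hK := hR.three_le_gap _ h.seg_pos h.seg_le
  have h5 := hR.five_le_incr _ h.seg_pos h.seg_le
  have hsums : ∀ i, (σ.s + entry x (t + 1)) i
      = colSum x (t + 1) i + histNoise P ω σ.seg i := by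
    intro i
    rw [colSum_succ]
    simp only [Pi.add_apply, h.sums]
    ring
  -- the maximum column sum is at most `2 Δ`
  have hM : maxSum x (t + 1) ≤ 2 * incr d P σ.seg := by
    by_cases hl : (σ.seg : ℝ) < lg P.T
    · have hc' : vmax (σ.s + entry x (t + 1)) + 8 / P.ε * ω (.segTest (t + 1))
          ≤ 2 ^ (σ.seg - 1) + 4 / P.ε * ω (.segThreshold σ.seg) :=
        not_lt.1 fun h' => hc ⟨h', hl⟩
      have a := vmax_le_add hd (u := colSum x (t + 1)) (v := σ.s + entry x (t + 1))
        (r := alphaGamma d P σ.seg) fun i => by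
          rw [hsums, abs_sub_comm, add_sub_cancel_left]
          exact hQ.hist _ h.seg_pos h.seg_le i
      have c1 := abs_scale_mul_le hR.ε_pos (by norm_num : (0 : ℝ) ≤ 8)
        (hQ.segTest (t + 1) (by omega) ht)
      have c2 := abs_scale_mul_le hR.ε_pos (by norm_num : (0 : ℝ) ≤ 4)
        (hQ.segThreshold _ h.seg_pos h.seg_le)
      have e : outerSlack P = 8 / P.ε * lg (3 * P.T / P.β) + 4 / P.ε * lg (3 * P.T / P.β) := by
        rw [outerSlack]
        ring
      have hle := hR.le_incr _ h.seg_pos h.seg_le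
      unfold maxSum
      linarith [(abs_le.1 c1).1, (abs_le.1 c2).2]
    -- In the last segment the outer test is disabled, but then T ≤ 2^j, and the trivial bound by T
    -- is as good.
    · have h1 : maxSum x (t + 1) ≤ P.T := (maxSum_le hd x _).trans (by exact_mod_cast ht)
      have hT : (0 : ℝ) < P.T := by exact_mod_cast hR.one_le_T
      have h2 : (P.T : ℝ) ≤ 2 ^ σ.seg := by
        have := not_lt.1 hl
        rw [lg, Real.logb_le_iff_le_rpow (by norm_num) hT, Real.rpow_natCast] at this
        exact this
      have h3 : (2 : ℝ) ^ σ.seg = 2 * 2 ^ (σ.seg - 1) := by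
        rw [← pow_succ', Nat.sub_add_cancel h.seg_pos]
      have h4 := hR.le_incr _ h.seg_pos h.seg_le
      have h6 := hR.gamma_nonneg _ h.seg_pos h.seg_le
      have h7 : 0 ≤ outerSlack P := by
        have := (abs_nonneg _).trans (hQ.segTest 1 le_rfl hR.one_le_T)
        have hε := hR.ε_pos
        unfold outerSlack
        positivity
      linarith
  have hmono := maxSum_mono hd x (h.le_now.trans (Nat.le_succ t))
  -- so the inner mechanism has not used up its intervals
  have hiv : ((m + 1 : ℕ) : ℝ) ≤ incr d P σ.seg := by
    have h0 := maxSum_nonneg hd x t₀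
    have hlow := h.low
    -- For m ≥ 1, K ≥ 3 gives 3m - 2 ≤ 2Δ, that is, m + 1 ≤ (2Δ + 5)/3. This is at most Δ exactly
    -- when Δ ≥ 5, whence `five_le_incr`.
    rcases Nat.eq_zero_or_pos m with hm | hm
    · rw [hm]
      norm_num
      linarith
    · have hm' : (1 : ℝ) ≤ m := by exact_mod_cast hm
      push_cast
      nlinarith
  have hs : ∀ i, |(σ.inner.s + entry x (t + 1)) i - colSum x (t + 1) i|
      ≤ alphaGamma d P σ.seg + treeErr d (P.ε / 2) P.βIn (incr d P σ.seg) := by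
    intro i
    have := h.abs_hist_sub_le hQ i
    rw [colSum_succ]
    simp only [Pi.add_apply, h.s, h.c]
    convert this using 2
    ring
  have hs' := abs_le.1 (abs_vmax_sub_le hd hs)
  have hb := abs_le.1 (abs_vmax_sub_le hd (u := σ.inner.base) (v := colSum x t₀)
    (r := alphaGamma d P σ.seg) fun i => by
      rw [h.base, add_sub_cancel_left]
      exact hQ.hist _ h.seg_pos h.seg_le i)
  have n1 := abs_le.1 (abs_scale_mul_le hR.ε_pos (by norm_num : (0 : ℝ) ≤ 8)
    (hQ.innerTest (t + 1) (by omega) ht))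
  have n2 := abs_le.1 (abs_scale_mul_le hR.ε_pos (by norm_num : (0 : ℝ) ≤ 4)
    (hQ.innerThreshold _ h.seg_pos h.seg_le (m + 1) (by omega) hiv))
  by_cases hA : vmax (σ.inner.s + entry x (t + 1)) + 8 / P.ε * ω (.innerTest (t + 1))
      > vmax σ.inner.base + (m + 1 : ℕ) * innerGap d P σ.seg
        + 4 / P.ε * ω (.innerThreshold σ.seg (m + 1))
  -- The new input goes to the unused slot m + 1, so earlier inputs survive and the sums telescope
  -- in time.
  · have hfed : ∀ k ∈ Finset.Ioc 0 m, ∀ v : Fin d → ℝ,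
        Function.update σ.inner.fed (m + 1) v k = σ.inner.fed k := by
      intro k hk v
      rw [Finset.mem_Ioc] at hk
      exact Function.update_of_ne (by omega) _ _
    refine ⟨t + 1, m + 1, ?_⟩
    unfold InnerState.step
    simp only [h.iv]
    rw [if_pos ⟨hA, hiv⟩]
    exact
    { seg_pos := h.seg_pos
      seg_le := h.seg_le
      reachable := h.reachable
      sums := hsums
      start_le := (h.start_le.trans h.le_now).trans (Nat.le_succ t)
      le_now := le_rfl
      base := h.base
      iv := rfl
      m_le := Nat.le_floor hiv
      fed := by
        intro i
        rw [Finset.sum_Ioc_succ_top (Nat.zero_le m),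
          Finset.sum_congr rfl fun k hk => congrFun (hfed k hk _) i, h.fed]
        simp only [Function.update_self, Pi.add_apply, h.c, colSum_succ]
        ring
      c := by simp
      s := by simp
      out := rfl
      inner_out := rfl
      -- The inner test fired, so the true maximum has reached threshold m + 1 up to the slack 2K/3.
      low := by
        simp only [maxSum]
        push_cast at *
        linarith
      high := Or.inl rfl }
  · refine ⟨t₁, m, ?_⟩
    unfold InnerState.step
    simp only [h.iv]
    rw [if_neg fun h' => hA h'.1]
    exact
    { seg_pos := h.seg_pos
      seg_le := h.seg_le
      reachable := h.reachable
      sums := hsums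
      start_le := h.start_le
      le_now := h.le_now.trans (Nat.le_succ t)
      base := h.base
      iv := rfl
      m_le := h.m_le
      fed := h.fed
      c := by
        intro i
        simp only [Pi.add_apply, h.c, colSum_succ]
        ring
      s := by
        intro i
        simp only [Pi.add_apply, h.s]
        ring
      out := h.inner_out.trans h.out
      inner_out := rfl
      low := h.low
      -- The inner test did not fire, or the interval cap was hit; the cap is excluded by `hiv`, so
      -- the failed comparison bounds the maximum from above.
      high := by
        right
        have hA' := not_lt.1 hA
        simp only [maxSum]
        push_cast at *
        linarith }

theorem exists_tracks (hR : Regular d P J (cMax x P.T)) (hQ : Quiet P J ω) {t : ℕ}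
    (ht : t ≤ P.T) : ∃ t₀ t₁ m, Tracks P J x ω t (stateAt P x ω t) t₀ t₁ m := by
  induction t with
  | zero => exact ⟨0, 0, 0, Tracks.init hR⟩
  | succ t ih =>
    obtain ⟨t₀, t₁, m, h⟩ := ih (by omega)
    rw [stateAt, State.step]
    by_cases hc : vmax ((stateAt P x ω t).s + entry x (t + 1)) + 8 / P.ε * ω (.segTest (t + 1))
        > 2 ^ ((stateAt P x ω t).seg - 1) + 4 / P.ε * ω (.segThreshold (stateAt P x ω t).seg)
          ∧ ((stateAt P x ω t).seg : ℝ) < lg P.T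
    · simp only [if_pos hc]
      exact ⟨_, _, _, h.endSegment hR hQ ht hc.1 hc.2 _ rfl⟩
    · simp only [if_neg hc]
      obtain ⟨t₁', m', h'⟩ := h.continueSegment hR hQ ht hc
      exact ⟨t₀, t₁', m', h'⟩

theorem maxError_le_of_quiet (hR : Regular d P J (cMax x P.T)) (hQ : Quiet P J ω) {α : ℝ}
    (hα : ∀ j, 1 ≤ j → j ≤ J → Reachable d P (cMax x P.T) j → 3 * innerGap d P j ≤ α) :
    maxError P.T (maxSum x) (mechanism P x ω) ≤ α := by
  refine maxError_le hR.one_le_T fun t ht => ?_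
  obtain ⟨t₀, t₁, m, h⟩ := exists_tracks hR hQ ht
  exact (h.abs_out_sub_le hR hQ).trans (hα _ h.seg_pos h.seg_le h.reachable)

end

/-! ### Binary logarithms -/

theorem lg_nonneg {y : ℝ} (h : 1 ≤ y) : 0 ≤ lg y := Real.logb_nonneg (by norm_num) h

theorem lg_mono {y z : ℝ} (hy : 0 < y) (h : y ≤ z) : lg y ≤ lg z :=
  Real.logb_le_logb_of_le (by norm_num) hy h

theorem lg_mul {y z : ℝ} (hy : 0 < y) (hz : 0 < z) : lg (y * z) = lg y + lg z :=
  Real.logb_mul hy.ne' hz.ne'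

theorem lg_div {y z : ℝ} (hy : 0 < y) (hz : 0 < z) : lg (y / z) = lg y - lg z :=
  Real.logb_div hy.ne' hz.ne'

theorem lg_pow (y : ℝ) (n : ℕ) : lg (y ^ n) = n * lg y := Real.logb_pow _ _ _

theorem lg_two_pow (n : ℕ) : lg (2 ^ n) = n := by
  rw [lg_pow, lg, Real.logb_self_eq_one (by norm_num), mul_one]

theorem lg_le_of_le_two_pow {y : ℝ} (hy : 0 < y) {n : ℕ} (h : y ≤ 2 ^ n) : lg y ≤ n := by
  rw [← lg_two_pow]
  exact lg_mono hy h

theorem le_lg_of_two_pow_le {y : ℝ} {n : ℕ} (h : 2 ^ n ≤ y) : n ≤ lg y := by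
  rw [← lg_two_pow]
  exact lg_mono (by positivity) h

/-- Equivalent to y < 2^y, which the quadratic lower bound of exp already gives: 1 + y log 2 + (y
log 2)²/2 - y has no real root. -/
theorem lg_lt_self {y : ℝ} (h : 0 < y) : lg y < y := by
  rw [lg, Real.logb_lt_iff_lt_rpow (by norm_num) h, Real.rpow_def_of_pos (by norm_num)]
  have h2 := Real.log_two_gt_d9
  have h3 := Real.quadratic_le_exp_of_nonneg (x := Real.log 2 * y) (by positivity)
  nlinarith [mul_pos h h, mul_self_nonneg (y - 2), mul_self_nonneg (Real.log 2 * y - y / 2)]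

/-- Binary logarithms exceed natural ones by the factor 1/log 2. That gain lets coefficient 1 yield
1/y and coefficient 3/2 yield 1/y². -/
theorem exp_neg_mul_lg_le {y u : ℝ} (h : 1 ≤ y) (n : ℕ) (hu : n * Real.log 2 ≤ u) :
    Real.exp (-(u * lg y)) ≤ 1 / y ^ n := by
  have hy : 0 < y := by linarith
  have h3 : 0 < Real.log 2 := Real.log_pos (by norm_num)
  have : n * Real.log y ≤ u * lg y := by
    rw [lg, Real.logb, mul_div_assoc', le_div_iff₀ h3]
    have := Real.log_nonneg h
    nlinarith
  calc Real.exp (-(u * lg y)) ≤ Real.exp (-(n * Real.log y)) := Real.exp_le_exp.2 (by linarith)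
    _ = 1 / y ^ n := by
      rw [Real.exp_neg, Real.exp_nat_mul, Real.exp_log hy, one_div]

/-! ### The noise is small with large probability -/

section

variable {d : ℕ}

theorem noiseLaw_abs_gt_lg (a : NoiseIdx d) {y : ℝ} (hy : 1 ≤ y) :
    noiseLaw d {ω | lg y < |ω a|} ≤ ENNReal.ofReal (1 / y) := by
  refine (noiseLaw_abs_gt a (lg_nonneg hy)).trans (ENNReal.ofReal_le_ofReal ?_)
  have h2 := Real.log_two_lt_d9
  have := exp_neg_mul_lg_le (u := 1) hy 1 (by norm_num; linarith)
  rwa [one_mul, pow_one] at this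

theorem measure_biUnion_le_card_mul {Ω ι : Type*} [MeasurableSpace Ω] (μ : Measure Ω)
    (S : Finset ι) (A : ι → Set Ω) {r R : ℝ} (hr : ∀ i ∈ S, μ (A i) ≤ ENNReal.ofReal r)
    (hR : S.card * r ≤ R) : μ (⋃ i ∈ S, A i) ≤ ENNReal.ofReal R := by
  refine (measure_biUnion_finset_le S A).trans ((Finset.sum_le_card_nsmul S _ _ hr).trans ?_)
  rw [nsmul_eq_mul, ← ENNReal.ofReal_natCast, ← ENNReal.ofReal_mul (by positivity)]
  exact ENNReal.ofReal_le_ofReal hR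

/-- At segment j only k = j - 1 noise vectors have been added, so L ≥ j - 1 is enough. The Chernoff
parameter 1/√(2k) keeps the moment generating factor bounded and makes the deviation scale as √L. -/
theorem noiseLaw_histNoise_gt (hd : 1 ≤ d) {P : Params} (hε : 0 < P.ε) {j : ℕ} (hj : 2 ≤ j)
    (hL : (j : ℝ) - 1 ≤ P.L j) (hy : 4 ≤ 3 * d * lg P.T / P.β) (i : Fin d) :
    noiseLaw d {ω | alphaGamma d P j < |histNoise P ω j i|}
      ≤ ENNReal.ofReal (1 / (3 * d * lg P.T / P.β)) := by
  have hd' : (0 : ℝ) < d := by exact_mod_cast hd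
  obtain ⟨k, rfl⟩ : ∃ k, j = k + 1 := ⟨j - 1, by omega⟩
  have hk : (1 : ℝ) ≤ k := by exact_mod_cast (by omega : 1 ≤ k)
  have hk0 : (0 : ℝ) < k := by linarith
  set y := 3 * d * lg P.T / P.β with hy_def
  let S : Finset (NoiseIdx d) := (Finset.Ico 1 (k + 1)).map
    ⟨fun j' => NoiseIdx.segHist j' i, fun a b h => by simpa using h⟩
  let s : ℝ := 2 * √2 * √(P.L (k + 1)) * lg y
  have hsub : {ω : NoiseIdx d → ℝ | alphaGamma d P (k + 1) < |histNoise P ω (k + 1) i|}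
      ⊆ {ω | s < |∑ a ∈ S, ω a|} := by
    intro ω hω
    have hω' : alphaGamma d P (k + 1) < |histNoise P ω (k + 1) i| := hω
    have e1 : alphaGamma d P (k + 1) = 2 * d / P.ε * s := by
      simp only [alphaGamma, s, ← hy_def]
      ring
    have e2 : histNoise P ω (k + 1) i = 2 * d / P.ε * ∑ a ∈ S, ω a := by
      rw [histNoise, Finset.sum_map]
      rfl
    rw [e1, e2, abs_mul, abs_of_nonneg (by positivity : (0 : ℝ) ≤ 2 * d / P.ε)] at hω'
    exact lt_of_mul_lt_mul_left hω' (by positivity)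
  have hcard : S.card = k := by simp [S]
  have hsq : (1 / √(2 * k)) ^ 2 = 1 / (2 * k) := by
    rw [div_pow, Real.sq_sqrt (by positivity), one_pow]
  have hu : 1 / √(2 * k) < 1 := by
    rw [div_lt_one (by positivity), Real.lt_sqrt (by norm_num)]
    linarith
  refine (measure_mono hsub).trans ((noiseLaw_abs_sum_gt S (u := 1 / √(2 * k)) (by positivity)
    hu).trans (ENNReal.ofReal_le_ofReal ?_))
  rw [hcard, hsq]
  -- Bernoulli's inequality: (1 - 1/(2k))^k ≥ 1/2.
  have h1 : ((1 - 1 / (2 * (k : ℝ)))⁻¹) ^ k ≤ 2 := by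
    have hb := one_add_mul_le_pow (a := -(1 / (2 * (k : ℝ)))) (by
      have : 1 / (2 * (k : ℝ)) ≤ 1 := by
        rw [div_le_one (by positivity)]
        linarith
      linarith) k
    have e : 1 + (k : ℝ) * -(1 / (2 * k)) = 1 / 2 := by
      field_simp
      norm_num
    rw [e, ← sub_eq_add_neg] at hb
    rw [inv_pow]
    exact inv_le_of_inv_le₀ (by norm_num) (by rw [inv_eq_one_div]; exact hb)
  have h2 : Real.exp (-(1 / √(2 * k)) * s) ≤ 1 / y ^ 2 := by
    have hs : √(k : ℝ) ≤ √(P.L (k + 1)) := by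
      apply Real.sqrt_le_sqrt
      push_cast at hL
      linarith
    have hl := Real.log_two_lt_d9
    have e : -(1 / √(2 * k)) * s = -((2 * (√(P.L (k + 1)) / √k)) * lg y) := by
      simp only [s]
      rw [Real.sqrt_mul (by norm_num)]
      have : √(2 : ℝ) ≠ 0 := by positivity
      have : √(k : ℝ) ≠ 0 := by positivity
      field_simp
    rw [e]
    have hr : 1 ≤ √(P.L (k + 1)) / √k := by
      rw [le_div_iff₀ (by positivity), one_mul]
      exact hs
    exact exp_neg_mul_lg_le (by linarith) 2 (by push_cast; linarith)
  have hy0 : 0 < y := by linarith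
  calc 2 * (Real.exp (-(1 / √(2 * k)) * s) * ((1 - 1 / (2 * (k : ℝ)))⁻¹) ^ k)
      ≤ 2 * (Real.exp (-(1 / √(2 * k)) * s) * 2) := by gcongr
    _ ≤ 2 * (1 / y ^ 2 * 2) := by gcongr
    -- The two factors 2 cost 4/y², which y ≥ 4 absorbs.
    _ ≤ 1 / y := by
      rw [show 2 * (1 / y ^ 2 * 2) = 4 / y ^ 2 by ring, div_le_div_iff₀ (by positivity) hy0]
      nlinarith

/-- One output involves at most ⌊log n⌋ + 1 tree variables. Chernoff with the fixed parameter 1/2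
loses at most a factor 2Δ, which the decay z⁻² outweighs; the remaining bound survives a union over
d columns and Δ outputs. -/
theorem noiseLaw_tree_gt (hd : 1 ≤ d) {P : Params} (hε : 0 < P.ε) (hβ : 0 < P.βIn)
    (hβ1 : P.βIn ≤ 1) {j : ℕ} (hΔ : 8 ≤ incr d P j) (i : Fin d) {m : ℕ}
    (hm : m ≤ ⌊incr d P j⌋₊) :
    noiseLaw d {ω | treeErr d (P.ε / 2) P.βIn (incr d P j)
        < |treeScale d (P.ε / 2) ⌊incr d P j⌋₊ * treeNoise ω j i m|}
      ≤ ENNReal.ofReal (P.βIn / (9 * d * incr d P j)) := by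
  have hd1 : (1 : ℝ) ≤ d := by exact_mod_cast hd
  have hd' : (0 : ℝ) < d := by linarith
  set Δ := incr d P j with hΔ_def
  set n := ⌊Δ⌋₊ with hn_def
  have hn : (n : ℝ) ≤ Δ := Nat.floor_le (by linarith)
  have hn0 : n ≠ 0 := by
    have : 8 ≤ n := Nat.le_floor (by exact_mod_cast hΔ)
    omega
  set k := Nat.log 2 n + 1 with hk_def
  have hk0 : (0 : ℝ) < k := by positivity
  have hkn : (2 : ℝ) ^ k ≤ 2 * Δ := by
    have : 2 ^ k ≤ 2 * n := by
      rw [hk_def, pow_succ']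
      exact Nat.mul_le_mul_left 2 (Nat.pow_log_le_self 2 hn0)
    have h' : (2 : ℝ) ^ k ≤ 2 * n := by exact_mod_cast this
    linarith
  have h3 : (3 : ℕ) ≤ lg Δ := le_lg_of_two_pow_le (by norm_num; exact hΔ)
  push_cast at h3
  -- The depth is at most 1 + log Δ, and Δ ≥ 8 makes the 1 at most a third of log Δ. This gives s ≥
  -- 3 lg z below.
  have hk : (k : ℝ) ≤ 4 / 3 * lg Δ := by
    have := le_lg_of_two_pow_le hkn
    rw [lg_mul (by norm_num) (by linarith)] at this
    have e : lg 2 = 1 := by simpa using lg_two_pow 1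
    linarith
  set z := 6 * d * Δ / P.βIn with hz_def
  have hz : 6 * d * Δ ≤ z := by
    rw [hz_def, le_div_iff₀ hβ]
    have : 0 ≤ 6 * d * Δ := by positivity
    nlinarith
  have hz1 : 1 ≤ z := by nlinarith
  let T := (Finset.range m.size).filter (fun level => m.testBit level = true)
  let S : Finset (NoiseIdx d) := T.map
    ⟨fun l => NoiseIdx.tree j i l (m / 2 ^ l), fun a b h => by
      simp only [NoiseIdx.tree.injEq, true_and] at h
      exact h.1⟩
  have hcard : S.card ≤ k := by
    rw [Finset.card_map]
    refine (Finset.card_filter_le _ _).trans ?_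
    rw [Finset.card_range, Nat.size_le]
    exact lt_of_le_of_lt hm (Nat.lt_pow_succ_log_self (by norm_num) n)
  let s : ℝ := 4 * lg Δ * lg z / k
  have hlz := lg_nonneg hz1
  have hs : 3 * lg z ≤ s := by
    simp only [s]
    rw [le_div_iff₀ hk0]
    nlinarith
  have hscale : treeScale d (P.ε / 2) n = k / (P.ε / 2 / d) := by
    rw [treeScale, hk_def]
    push_cast
    rfl
  have hsub : {ω : NoiseIdx d → ℝ | treeErr d (P.ε / 2) P.βIn Δ
      < |treeScale d (P.ε / 2) n * treeNoise ω j i m|} ⊆ {ω | s < |∑ a ∈ S, ω a|} := by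
    intro ω hω
    have hω' : treeErr d (P.ε / 2) P.βIn Δ
      < |treeScale d (P.ε / 2) n * treeNoise ω j i m| := hω
    have e1 : treeErr d (P.ε / 2) P.βIn Δ = k / (P.ε / 2 / d) * s := by
      simp only [treeErr, s, ← hz_def]
      field_simp
    have e2 : treeNoise ω j i m = ∑ a ∈ S, ω a := by
      rw [treeNoise, Finset.sum_map]
      rfl
    rw [hscale, e1, e2, abs_mul,
      abs_of_nonneg (by positivity : (0 : ℝ) ≤ k / (P.ε / 2 / d))] at hω'
    exact lt_of_mul_lt_mul_left hω' (by positivity)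
  refine (measure_mono hsub).trans ((noiseLaw_abs_sum_gt S (u := 1 / 2) (by norm_num)
    (by norm_num)).trans (ENNReal.ofReal_le_ofReal ?_))
  have h1 : ((1 - (1 / 2 : ℝ) ^ 2)⁻¹) ^ S.card ≤ 2 * Δ := by
    calc ((1 - (1 / 2 : ℝ) ^ 2)⁻¹) ^ S.card ≤ 2 ^ S.card := by
          gcongr
          norm_num
      _ ≤ 2 ^ k := pow_le_pow_right₀ (by norm_num) hcard
      _ ≤ 2 * Δ := hkn
  have h2 : Real.exp (-(1 / 2) * s) ≤ 1 / z ^ 2 := by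
    refine le_trans (Real.exp_le_exp.2 ?_) (exp_neg_mul_lg_le (u := 3 / 2) hz1 2 ?_)
    · linarith
    · have := Real.log_two_lt_d9
      push_cast
      linarith
  have hz0 : 0 < z := by linarith
  calc 2 * (Real.exp (-(1 / 2) * s) * ((1 - (1 / 2 : ℝ) ^ 2)⁻¹) ^ S.card)
      ≤ 2 * (1 / z ^ 2 * (2 * Δ)) := by gcongr
    _ = P.βIn / (9 * d * Δ) * (P.βIn / d) := by
      rw [hz_def]
      field_simp
      norm_num
    _ ≤ P.βIn / (9 * d * Δ) * 1 := by
      gcongr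
      rw [div_le_one hd']
      linarith
    _ = _ := mul_one _

/-- Conditions under which the noise is small with probability more than `1 - 2 β`. -/
structure FewSegments (d : ℕ) (P : Params) (J : ℕ) : Prop where
  one_le_d : 1 ≤ d
  two_le_T : 2 ≤ P.T
  ε_pos : 0 < P.ε
  β_pos : 0 < P.β
  β_le : P.β ≤ 1 / 2
  pred_le_L : ∀ j, 1 ≤ j → j ≤ J → (j : ℝ) - 1 ≤ P.L j
  lt_lg_T : (J : ℝ) < lg P.T + 1
  one_le_J : 1 ≤ J
  βIn_pos : 0 < P.βIn
  βIn_le : P.βIn ≤ P.β / 3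
  mul_βIn_le : J * P.βIn ≤ 2 * P.β / 3
  eight_le_incr : ∀ j, 1 ≤ j → j ≤ J → 8 ≤ incr d P j

theorem one_le_lg_natCast {T : ℕ} (hT : 2 ≤ T) : 1 ≤ lg T := by
  have h : (2 : ℝ) ^ 1 ≤ (T : ℝ) := by
    rw [pow_one]
    exact_mod_cast hT
  have := le_lg_of_two_pow_le h
  simpa using this

theorem alphaGamma_nonneg {P : Params} (hd : 1 ≤ d) (hT : 2 ≤ P.T) (hε : 0 < P.ε)
    (hβ : 0 < P.β) (hβ1 : P.β ≤ 1 / 2) (j : ℕ) : 0 ≤ alphaGamma d P j := by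
  have hd' : (1 : ℝ) ≤ d := by exact_mod_cast hd
  have hT' := one_le_lg_natCast hT
  have : 0 ≤ lg (3 * d * lg P.T / P.β) := by
    apply lg_nonneg
    rw [le_div_iff₀ hβ]
    nlinarith
  unfold alphaGamma
  positivity

/-- Three outer families cost β/3 each. The inner ones cost βIn/3 in total for the comparisons, and
βIn/3 and βIn/9 per segment for thresholds and trees; J βIn ≤ 2β/3 keeps the sum below 2β. -/
theorem noiseLaw_not_quiet_lt {P : Params} {J : ℕ} (h : FewSegments d P J) :
    noiseLaw d {ω | ¬ Quiet P J ω} < ENNReal.ofReal (2 * P.β) := by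
  obtain ⟨hd, hT, hε, hβ, hβ1, hL, hJT, hJ, hI, hI1, hI2, hΔ⟩ := h
  have hd' : (1 : ℝ) ≤ d := by exact_mod_cast hd
  have hT' : (2 : ℝ) ≤ P.T := by exact_mod_cast hT
  have hlT := one_le_lg_natCast hT
  have hJT' : (J : ℝ) ≤ P.T := by
    have : (J : ℝ) < P.T + 1 := hJT.trans (by linarith [lg_lt_self (by linarith : (0 : ℝ) < P.T)])
    have : J < P.T + 1 := by exact_mod_cast this
    exact_mod_cast Nat.lt_succ_iff.1 this
  have hJ' : (1 : ℝ) ≤ J := by exact_mod_cast hJ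
  have y1 : 1 ≤ 3 * P.T / P.β := by
    rw [le_div_iff₀ hβ]
    linarith
  have y2 : 1 ≤ 3 * P.T / P.βIn := by
    rw [le_div_iff₀ hI]
    linarith
  have y3 : 4 ≤ 3 * d * lg P.T / P.β := by
    rw [le_div_iff₀ hβ]
    nlinarith
  let U1 : Set (NoiseIdx d → ℝ) := ⋃ t ∈ Finset.Icc 1 P.T,
    {ω | lg (3 * P.T / P.β) < |ω (.segTest t)|}
  let U2 : Set (NoiseIdx d → ℝ) := ⋃ j ∈ Finset.Icc 1 J,
    {ω | lg (3 * P.T / P.β) < |ω (.segThreshold j)|}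
  let U3 : Set (NoiseIdx d → ℝ) := ⋃ p ∈ Finset.Icc 2 J ×ˢ (Finset.univ : Finset (Fin d)),
    {ω | alphaGamma d P p.1 < |histNoise P ω p.1 p.2|}
  let U4 : Set (NoiseIdx d → ℝ) := ⋃ t ∈ Finset.Icc 1 P.T,
    {ω | lg (3 * P.T / P.βIn) < |ω (.innerTest t)|}
  let U5 : Set (NoiseIdx d → ℝ) := ⋃ j ∈ Finset.Icc 1 J, ⋃ l ∈ Finset.Icc 1 ⌊incr d P j⌋₊,
    {ω | lg (3 * incr d P j / P.βIn) < |ω (.innerThreshold j l)|}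
  let U6 : Set (NoiseIdx d → ℝ) := ⋃ j ∈ Finset.Icc 1 J,
    ⋃ p ∈ (Finset.univ : Finset (Fin d)) ×ˢ Finset.Icc 1 ⌊incr d P j⌋₊,
    {ω | treeErr d (P.ε / 2) P.βIn (incr d P j)
      < |treeScale d (P.ε / 2) ⌊incr d P j⌋₊ * treeNoise ω j p.1 p.2|}
  have hsub : {ω | ¬ Quiet P J ω} ⊆ U1 ∪ (U2 ∪ (U3 ∪ (U4 ∪ (U5 ∪ U6)))) := by
    intro ω hω
    by_contra hc
    simp only [U1, U2, U3, U4, U5, U6, Set.mem_union, not_or, Set.mem_iUnion, not_exists,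
      Set.mem_ofPred_eq, not_lt, Finset.mem_Icc, Finset.mem_product, Finset.mem_univ, true_and,
      and_true, and_imp, Prod.forall] at hc
    obtain ⟨c1, c2, c3, c4, c5, c6⟩ := hc
    refine hω ⟨c1, c2, fun j j1 j2 i => ?_, c4, fun j j1 j2 l l1 l2 => ?_,
      fun j j1 j2 i m hm => ?_⟩
    -- Segment 1 carries no accumulated noise, so only J - 1 < log T segments enter the union bound.
    · rcases Nat.lt_or_ge j 2 with hj | hj
      · obtain rfl : j = 1 := by omega
        simpa [histNoise] using alphaGamma_nonneg hd hT hε hβ hβ1 1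
      · exact c3 j i hj j2
    · exact c5 j j1 j2 l l1 (Nat.le_floor l2)
    · rcases Nat.eq_zero_or_pos m with rfl | h0
      · have h8 := hΔ j j1 j2
        have z1 : 1 ≤ 6 * d * incr d P j / P.βIn := by
          rw [le_div_iff₀ hI]
          nlinarith
        have := lg_nonneg z1
        have := lg_nonneg (by linarith : 1 ≤ incr d P j)
        have h0 : treeNoise ω j i 0 = 0 := by simp [treeNoise]
        rw [h0, mul_zero, abs_zero, treeErr]
        positivity
      · exact c6 j j1 j2 i m h0 hm
  have b1 : noiseLaw d U1 ≤ ENNReal.ofReal (P.β / 3) := by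
    refine measure_biUnion_le_card_mul _ _ _ (fun t _ => noiseLaw_abs_gt_lg _ y1) (le_of_eq ?_)
    rw [Nat.card_Icc, Nat.add_sub_cancel]
    field_simp
  have b2 : noiseLaw d U2 ≤ ENNReal.ofReal (P.β / 3) := by
    refine measure_biUnion_le_card_mul _ _ _ (fun t _ => noiseLaw_abs_gt_lg _ y1) ?_
    rw [Nat.card_Icc, Nat.add_sub_cancel, one_div_div]
    calc J * (P.β / (3 * P.T)) ≤ P.T * (P.β / (3 * P.T)) := by gcongr
      _ = P.β / 3 := by field_simp
  have b3 : noiseLaw d U3 ≤ ENNReal.ofReal (P.β / 3) := by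
    refine measure_biUnion_le_card_mul _ _ _ (r := 1 / (3 * d * lg P.T / P.β)) (fun p hp => ?_) ?_
    · rw [Finset.mem_product, Finset.mem_Icc] at hp
      exact noiseLaw_histNoise_gt hd hε hp.1.1 (hL _ (by omega) hp.1.2) y3 _
    · rw [Finset.card_product, Nat.card_Icc, Finset.card_univ, Fintype.card_fin, one_div_div]
      have e : ((J + 1 - 2 : ℕ) : ℝ) = J - 1 := by
        rw [show J + 1 - 2 = J - 1 by omega, Nat.cast_sub hJ, Nat.cast_one]
      rw [Nat.cast_mul, e]
      calc ((J : ℝ) - 1) * d * (P.β / (3 * d * lg P.T))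
          ≤ lg P.T * d * (P.β / (3 * d * lg P.T)) := by
            gcongr
            linarith
        _ = P.β / 3 := by field_simp
  have b4 : noiseLaw d U4 ≤ ENNReal.ofReal (P.β / 9) := by
    refine measure_biUnion_le_card_mul _ _ _ (fun t _ => noiseLaw_abs_gt_lg _ y2) ?_
    rw [Nat.card_Icc, Nat.add_sub_cancel, one_div_div]
    calc P.T * (P.βIn / (3 * P.T)) = P.βIn / 3 := by field_simp
      _ ≤ P.β / 9 := by linarith
  have b5 : noiseLaw d U5 ≤ ENNReal.ofReal (2 * P.β / 9) := by
    refine measure_biUnion_le_card_mul _ _ _ (r := P.βIn / 3) (fun j hj => ?_) ?_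
    · rw [Finset.mem_Icc] at hj
      have h8 := hΔ j hj.1 hj.2
      refine measure_biUnion_le_card_mul _ _ _ (fun l _ => noiseLaw_abs_gt_lg _ ?_) ?_
      · rw [le_div_iff₀ hI]
        linarith
      · rw [Nat.card_Icc, Nat.add_sub_cancel, one_div_div]
        calc (⌊incr d P j⌋₊ : ℝ) * (P.βIn / (3 * incr d P j))
            ≤ incr d P j * (P.βIn / (3 * incr d P j)) := by
              gcongr
              exact Nat.floor_le (by linarith)
          _ = P.βIn / 3 := by field_simp
    · rw [Nat.card_Icc, Nat.add_sub_cancel]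
      linarith
  have b6 : noiseLaw d U6 ≤ ENNReal.ofReal (2 * P.β / 27) := by
    refine measure_biUnion_le_card_mul _ _ _ (r := P.βIn / 9) (fun j hj => ?_) ?_
    · rw [Finset.mem_Icc] at hj
      have h8 := hΔ j hj.1 hj.2
      refine measure_biUnion_le_card_mul _ _ _ (r := P.βIn / (9 * d * incr d P j))
        (fun p hp => ?_) ?_
      · rw [Finset.mem_product, Finset.mem_Icc] at hp
        exact noiseLaw_tree_gt hd hε hI (by linarith) h8 _ hp.2.2
      · rw [Finset.card_product, Nat.card_Icc, Nat.add_sub_cancel, Finset.card_univ,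
          Fintype.card_fin, Nat.cast_mul]
        calc (d : ℝ) * ⌊incr d P j⌋₊ * (P.βIn / (9 * d * incr d P j))
            ≤ d * incr d P j * (P.βIn / (9 * d * incr d P j)) := by
              gcongr
              exact Nat.floor_le (by linarith)
          _ = P.βIn / 9 := by field_simp
    · rw [Nat.card_Icc, Nat.add_sub_cancel]
      linarith
  calc noiseLaw d {ω | ¬ Quiet P J ω}
      ≤ noiseLaw d (U1 ∪ (U2 ∪ (U3 ∪ (U4 ∪ (U5 ∪ U6))))) := measure_mono hsub
    _ ≤ noiseLaw d U1 + (noiseLaw d U2 + (noiseLaw d U3 + (noiseLaw d U4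
        + (noiseLaw d U5 + noiseLaw d U6)))) := by
      iterate 5 refine (measure_union_le _ _).trans (add_le_add le_rfl ?_)
      exact le_rfl
    _ ≤ ENNReal.ofReal (P.β / 3) + (ENNReal.ofReal (P.β / 3) + (ENNReal.ofReal (P.β / 3)
        + (ENNReal.ofReal (P.β / 9) + (ENNReal.ofReal (2 * P.β / 9)
          + ENNReal.ofReal (2 * P.β / 27))))) := by gcongr
    _ = ENNReal.ofReal (P.β / 3 + (P.β / 3 + (P.β / 3 + (P.β / 9 + (2 * P.β / 9
          + 2 * P.β / 27))))) := by
      repeat rw [ENNReal.ofReal_add (by positivity) (by positivity)]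
    _ < ENNReal.ofReal (2 * P.β) := by
      rw [ENNReal.ofReal_lt_ofReal_iff (by positivity)]
      linarith

end

/-! ### Size of the parameters -/

theorem lg_one_div {y : ℝ} : lg (1 / y) = -lg y := by
  rw [lg, one_div, Real.logb_inv]
  rfl

theorem lg_two : lg 2 = 1 := by simpa using lg_two_pow 1

theorem lg_three_le : lg 3 ≤ 8 / 5 := by
  have h := lg_le_of_le_two_pow (y := 3 ^ 5) (n := 8) (by norm_num) (by norm_num)
  rw [lg_pow] at h
  push_cast at h
  linarith

theorem le_lg_three : 3 / 2 ≤ lg 3 := by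
  have h := le_lg_of_two_pow_le (y := 3 ^ 2) (n := 3) (by norm_num)
  rw [lg_pow] at h
  push_cast at h
  linarith

/-- The parameters of the problem. -/
structure Problem (d T : ℕ) (ε β c : ℝ) : Prop where
  one_le_d : 1 ≤ d
  two_le_T : 2 ≤ T
  ε_pos : 0 < ε
  ε_le : ε ≤ 1
  β_pos : 0 < β
  β_le : β ≤ 1 / 2
  one_le_c : 1 ≤ c

/-- A choice of `L` and `βIn` for which the mechanism is accurate on streams with maximum column sum
at most `c`, with at most `J` segments. -/
structure Suitable (d : ℕ) (P : Params) (J : ℕ) (c : ℝ) : Prop where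
  pred_le_L : ∀ j, 1 ≤ j → j ≤ J → (j : ℝ) - 1 ≤ P.L j
  one_le_L : ∀ j, 1 ≤ j → j ≤ J → 1 ≤ P.L j
  L_le : ∀ j, P.L j ≤ j ∨
    P.L j ≤ 12 * (lg (d * c / P.ε) + (1 + lg (lg (d * P.T * c / (P.ε * P.β)))))
  lt_lg_T : (J : ℝ) < lg P.T + 1
  one_le_J : 1 ≤ J
  βIn_pos : 0 < P.βIn
  βIn_le : P.βIn ≤ P.β / 3
  mul_βIn_le : J * P.βIn ≤ 2 * P.β / 3
  le_βIn : P.β ≤ 72 * lg (d * P.T * c / (P.ε * P.β)) * P.βIn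
  succ_le : ∀ j, 1 ≤ j → j ≤ J → MayEnd d P c j → j + 1 ≤ J

/-! ### Logarithms of the problem data -/

namespace Problem

variable {d T : ℕ} {ε β c : ℝ}

theorem one_le_d' (h : Problem d T ε β c) : (1 : ℝ) ≤ d := by exact_mod_cast h.one_le_d

theorem two_le_T' (h : Problem d T ε β c) : (2 : ℝ) ≤ T := by exact_mod_cast h.two_le_T

theorem one_le_neg_lg_β (h : Problem d T ε β c) : 1 ≤ -lg β := by
  have := lg_mono h.β_pos h.β_le
  rw [lg_one_div, lg_two] at this
  linarith

theorem lg_ε_nonpos (h : Problem d T ε β c) : lg ε ≤ 0 := by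
  have := lg_mono h.ε_pos h.ε_le
  simpa [lg] using this

theorem lg_all (h : Problem d T ε β c) :
    lg (d * T * c / (ε * β)) = lg d + lg T + lg c - lg ε - lg β := by
  obtain ⟨-, -, hε, -, hβ, -, hc⟩ := id h
  have := h.one_le_d'
  have := h.two_le_T'
  rw [lg_div (by positivity) (by positivity), lg_mul (by positivity) (by positivity),
    lg_mul (by positivity) (by positivity), lg_mul hε hβ]
  ring

theorem lg_count (h : Problem d T ε β c) : lg (d * c / ε) = lg d + lg c - lg ε := by
  obtain ⟨-, -, hε, -, hβ, -, hc⟩ := id h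
  have := h.one_le_d'
  rw [lg_div (by positivity) hε, lg_mul (by positivity) (by positivity)]

theorem lg_count_nonneg (h : Problem d T ε β c) : 0 ≤ lg (d * c / ε) := by
  rw [h.lg_count]
  have := h.lg_ε_nonpos
  have := lg_nonneg h.one_le_c
  have := lg_nonneg h.one_le_d'
  linarith

/-- The logarithm of all data splits into the part log(d c/ε), which may occur squared in the error,
and log T + log(1/β), which may enter it only linearly or through iterated logarithms, apart from
the factor log(d/β). -/
theorem lg_count_add_two_le (h : Problem d T ε β c) :
    lg (d * c / ε) + lg T - lg β = lg (d * T * c / (ε * β)) ∧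
    lg (d * c / ε) + 2 ≤ lg (d * T * c / (ε * β)) := by
  have := h.one_le_neg_lg_β
  have := one_le_lg_natCast h.two_le_T
  rw [h.lg_count, h.lg_all]
  constructor <;> linarith

theorem one_le_lg_lg (h : Problem d T ε β c) : 1 ≤ lg (lg (d * T * c / (ε * β))) := by
  have h1 := h.lg_count_add_two_le.2
  have h2 := h.lg_count_nonneg
  have := lg_mono (y := 2) (by norm_num) (by linarith : 2 ≤ lg (d * T * c / (ε * β)))
  rwa [lg_two] at this

/-- Absorbing powers of `lg (d c / ε)` and iterated logarithms into the error bound. -/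
theorem mul_sq_le (h : Problem d T ε β c) {l : ℝ} (hl : 1 ≤ l) :
    d * (lg (d * c / ε) + l) ^ 2 * lg (d / β)
      ≤ 4 * l ^ 2 * (d * lg (d / β) * lg (d * c / ε) ^ 2 + lg (T / (ε * β))) := by
  have hd := h.one_le_d'
  have hA := h.lg_count_nonneg
  have hb := h.one_le_neg_lg_β
  have hε := h.lg_ε_nonpos
  have hT := one_le_lg_natCast h.two_le_T
  have hT' := h.two_le_T'
  have hld := lg_nonneg hd
  have hB : lg (d / β) = lg d - lg β := lg_div (by linarith) h.β_pos
  have hS : lg (T / (ε * β)) = lg T - lg ε - lg β := by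
    rw [lg_div (by linarith) (mul_pos h.ε_pos h.β_pos), lg_mul h.ε_pos h.β_pos]
    ring
  have hB1 : 1 ≤ lg (d / β) := by linarith
  have hS1 : 1 ≤ lg (T / (ε * β)) := by linarith
  rcases le_or_gt 1 (lg (d * c / ε)) with h1 | h1
  · have e : (lg (d * c / ε) + l) ^ 2 ≤ (2 * lg (d * c / ε) * l) ^ 2 := by
      have : lg (d * c / ε) + l ≤ 2 * lg (d * c / ε) * l := by nlinarith
      gcongr
    calc d * (lg (d * c / ε) + l) ^ 2 * lg (d / β)
        ≤ d * (2 * lg (d * c / ε) * l) ^ 2 * lg (d / β) := by gcongr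
      _ = 4 * l ^ 2 * (d * lg (d / β) * lg (d * c / ε) ^ 2) := by ring
      _ ≤ _ := by
        gcongr
        linarith
  -- If log(d c/ε) < 1, its square may be too small to absorb anything. But then d = 1, and log(d/β)
  -- is dominated by the second summand log(T/(εβ)).
  · have hd1 : (d : ℝ) = 1 := by
      by_contra hne
      have h2 : 2 ≤ d := by
        have h1 := h.one_le_d
        have : d ≠ 1 := fun h => hne (by rw [h, Nat.cast_one])
        omega
      have := one_le_lg_natCast h2
      have := lg_nonneg h.one_le_c
      rw [h.lg_count] at h1
      linarith
    have hBS : lg (d / β) ≤ lg (T / (ε * β)) := by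
      rw [hB, hS, hd1]
      simp only [lg, Real.logb_one] at *
      linarith
    have e : (lg (d * c / ε) + l) ^ 2 ≤ (2 * l) ^ 2 := by
      have : lg (d * c / ε) + l ≤ 2 * l := by linarith
      gcongr
    calc d * (lg (d * c / ε) + l) ^ 2 * lg (d / β)
        ≤ d * (2 * l) ^ 2 * lg (T / (ε * β)) := by gcongr
      _ = 4 * l ^ 2 * lg (T / (ε * β)) := by
        rw [hd1]
        ring
      _ ≤ _ := by
        gcongr
        have : 0 ≤ d * lg (d / β) * lg (d * c / ε) ^ 2 := by positivity
        linarith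

end Problem

/-! ### Bounds for the mechanism's parameters in reachable segments -/

section

variable {d J : ℕ} {P : Params} {c : ℝ}

theorem four_mul_sqrt_two_le : 4 * √2 ≤ 6 := by
  have : √2 ≤ 3 / 2 := by
    rw [Real.sqrt_le_left (by norm_num)]
    norm_num
  linarith

theorem lg_gamma_eq (h : Problem d P.T P.ε P.β c) :
    lg (3 * d * lg P.T / P.β) = lg 3 + lg d + lg (lg P.T) - lg P.β := by
  have := h.one_le_d'
  have := one_le_lg_natCast h.two_le_T
  rw [lg_div (by positivity) h.β_pos, lg_mul (by positivity) (by positivity),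
    lg_mul (by positivity) (by positivity)]

theorem lg_three_mul_T_eq (h : Problem d P.T P.ε P.β c) :
    lg (3 * P.T / P.β) = lg 3 + lg P.T - lg P.β := by
  have := h.two_le_T'
  rw [lg_div (by positivity) h.β_pos, lg_mul (by positivity) (by positivity)]

/-- A sharper bound for `α_Γ`, which keeps `lg (d c / ε)` apart from iterated logarithms. -/
theorem alphaGamma_le (h : Problem d P.T P.ε P.β c) {j : ℕ} {W S : ℝ} (hS : √(P.L j) ≤ S)
    (hW : 1 + lg (lg (d * P.T * c / (P.ε * P.β))) ≤ W) :
    alphaGamma d P j ≤ 6 * S * (d / P.ε) * (W + 1 + lg (d / P.β)) := by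
  have hd := h.one_le_d'
  have hε := h.ε_pos
  have hT := one_le_lg_natCast h.two_le_T
  have hb := h.one_le_neg_lg_β
  have hQ : lg P.T ≤ lg (d * P.T * c / (P.ε * P.β)) := by
    have := h.lg_count_nonneg
    rw [← h.lg_count_add_two_le.1]
    linarith
  have hlQ := lg_mono (by linarith) hQ
  have hl3 := lg_three_le
  have hld := lg_nonneg hd
  have hlT := lg_nonneg hT
  have hl3' := le_lg_three
  have e : lg (3 * d * lg P.T / P.β) ≤ W + 1 + lg (d / P.β) := by
    rw [lg_gamma_eq h, lg_div (by linarith) h.β_pos]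
    linarith
  have e0 : 0 ≤ lg (3 * d * lg P.T / P.β) := by
    rw [lg_gamma_eq h]
    linarith
  have hS0 : 0 ≤ S := (Real.sqrt_nonneg _).trans hS
  calc alphaGamma d P j
      = 4 * √2 * √(P.L j) * (d / P.ε) * lg (3 * d * lg P.T / P.β) := by
        rw [alphaGamma]
        ring
    _ ≤ 6 * S * (d / P.ε) * (W + 1 + lg (d / P.β)) := by
        have := four_mul_sqrt_two_le
        gcongr

theorem outerSlack_le (h : Problem d P.T P.ε P.β c) :
    outerSlack P ≤ 12 * (d / P.ε) * lg (d * P.T * c / (P.ε * P.β)) ^ 2 := by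
  have hd := h.one_le_d'
  have hε := h.ε_pos
  have hb := h.one_le_neg_lg_β
  have hA := h.lg_count_nonneg
  obtain ⟨h1, h2⟩ := h.lg_count_add_two_le
  have hl3 := lg_three_le
  set Q := lg (d * P.T * c / (P.ε * P.β))
  have e : lg (3 * P.T / P.β) ≤ Q ^ 2 := by
    rw [lg_three_mul_T_eq h]
    nlinarith
  have hr : 1 ≤ (d : ℝ) := hd
  calc outerSlack P ≤ 12 / P.ε * Q ^ 2 := by
        rw [outerSlack]
        gcongr
    _ ≤ 12 / P.ε * Q ^ 2 * d := le_mul_of_one_le_right (by positivity) hd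
    _ = _ := by ring

theorem Suitable.L_le_lg (h : Problem d P.T P.ε P.β c) (hS : Suitable d P J c) {j : ℕ}
    (hj : j ≤ J) : P.L j ≤ 24 * lg (d * P.T * c / (P.ε * P.β)) := by
  have hA := h.lg_count_nonneg
  obtain ⟨h1, h2⟩ := h.lg_count_add_two_le
  have hb := h.one_le_neg_lg_β
  have hQ := lg_lt_self (by linarith : 0 < lg (d * P.T * c / (P.ε * P.β)))
  rcases hS.L_le j with hL | hL
  · have h3 : (j : ℝ) ≤ J := by exact_mod_cast hj
    have := hS.lt_lg_T
    linarith
  · linarith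

/-- A crude bound for `α_Γ`. -/
theorem Suitable.alphaGamma_le (h : Problem d P.T P.ε P.β c) (hS : Suitable d P J c) {j : ℕ}
    (hj : j ≤ J) :
    alphaGamma d P j ≤ 432 * (d / P.ε) * lg (d * P.T * c / (P.ε * P.β)) ^ 2 := by
  have hd := h.one_le_d'
  have hε := h.ε_pos
  have hA := h.lg_count_nonneg
  obtain ⟨h1, h2⟩ := h.lg_count_add_two_le
  have hl := hS.L_le_lg h hj
  have hT := one_le_lg_natCast h.two_le_T
  have h5 := h.lg_count
  have h6 := lg_nonneg h.one_le_c
  have h7 := h.lg_ε_nonpos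
  have h8 : lg (d / P.β) = lg d - lg P.β := lg_div (by linarith) h.β_pos
  have hQ := lg_lt_self (by linarith : 0 < lg (d * P.T * c / (P.ε * P.β)))
  set Q := lg (d * P.T * c / (P.ε * P.β)) with hQ_def
  have e : √(P.L j) ≤ 24 * Q := by
    rw [Real.sqrt_le_left (by linarith)]
    nlinarith
  have hQ0 : 0 ≤ Q := by linarith
  refine (TwoLevel.alphaGamma_le h e le_rfl).trans ?_
  calc 6 * (24 * Q) * (d / P.ε) * (1 + lg Q + 1 + lg (d / P.β))
      ≤ 6 * (24 * Q) * (d / P.ε) * (3 * Q) := by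
        gcongr
        linarith
    _ = 432 * (d / P.ε) * Q ^ 2 := by ring

/-- The previous segment ended, which bounds its threshold by c plus noise bounds, and thresholds
only double. The constant is 2(1 + 432 + 12). -/
theorem Suitable.two_pow_le (h : Problem d P.T P.ε P.β c) (hS : Suitable d P J c) {j : ℕ}
    (hj : j ≤ J) (hr : Reachable d P c j) :
    2 ^ (j - 1) ≤ 890 * (d * c / P.ε) * lg (d * P.T * c / (P.ε * P.β)) ^ 2 := by
  have hd := h.one_le_d'
  have hε := h.ε_pos
  have hc := h.one_le_c
  have hA := h.lg_count_nonneg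
  obtain ⟨h1, h2⟩ := h.lg_count_add_two_le
  have h3 := outerSlack_le h
  set Q := lg (d * P.T * c / (P.ε * P.β)) with hQ_def
  have hQ2 : 1 ≤ Q ^ 2 := by nlinarith
  have hdε : 1 ≤ d / P.ε := by
    rw [le_div_iff₀ hε]
    linarith [h.ε_le]
  have hN : d / P.ε ≤ d * c / P.ε := by
    gcongr
    nlinarith
  have hNc : c ≤ d * c / P.ε * Q ^ 2 := by
    calc c = 1 * c * 1 := by ring
      _ ≤ d / P.ε * c * Q ^ 2 := by gcongr
      _ = _ := by ring
  have hNQ : d / P.ε * Q ^ 2 ≤ d * c / P.ε * Q ^ 2 := by gcongr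
  rcases hr with rfl | ⟨i, rfl, hi, hm⟩
  · simp only [Nat.sub_self, pow_zero]
    linarith
  · have h4 := hS.alphaGamma_le h (by omega : i ≤ J)
    have e : (2 : ℝ) ^ (i + 1 - 1) = 2 * 2 ^ (i - 1) := by
      rw [← pow_succ', Nat.sub_add_cancel hi, Nat.add_sub_cancel]
    rw [e]
    have := hm.2
    linarith

/-- A crude polynomial bound suffices, since only log Δ enters K. The constant 890 + 2(12 + 432 +
12) is rounded up to a power of two. -/
theorem Suitable.incr_le (h : Problem d P.T P.ε P.β c) (hS : Suitable d P J c) {j : ℕ}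
    (hj : j ≤ J) (hr : Reachable d P c j) :
    incr d P j ≤ 2 ^ 11 * (d * c / P.ε) * lg (d * P.T * c / (P.ε * P.β)) ^ 2 := by
  have hd := h.one_le_d'
  have hε := h.ε_pos
  have hc := h.one_le_c
  have hA := h.lg_count_nonneg
  obtain ⟨h1, h2⟩ := h.lg_count_add_two_le
  have h3 := outerSlack_le h
  have h4 := hS.alphaGamma_le h hj
  have h5 := hS.two_pow_le h hj hr
  have h6 := hS.L_le_lg h hj
  set Q := lg (d * P.T * c / (P.ε * P.β)) with hQ_def
  have hdε : 1 ≤ d / P.ε := by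
    rw [le_div_iff₀ hε]
    linarith [h.ε_le]
  have hN : d / P.ε ≤ d * c / P.ε := by
    gcongr
    nlinarith
  have hNQ : d / P.ε * Q ^ 2 ≤ d * c / P.ε * Q ^ 2 := by gcongr
  have hQQ : 2 * Q ≤ d / P.ε * Q ^ 2 := by
    have : 2 * Q ≤ Q ^ 2 := by nlinarith
    nlinarith
  unfold incr alphaDM
  have : 12 / P.ε * lg (3 * P.T / P.β) = outerSlack P := rfl
  rw [this]
  linarith

theorem lg_le_of_le_mul {Q N y : ℝ} {n : ℕ} (hQ : 0 < Q) (hN : 0 < N) (hy : 0 < y)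
    (h : y ≤ 2 ^ n * N * Q ^ 2) : lg y ≤ n + lg N + 2 * lg Q := by
  have := lg_mono hy h
  rwa [lg_mul (by positivity) (by positivity), lg_mul (by positivity) hN, lg_two_pow, lg_pow,
    Nat.cast_ofNat] at this

theorem Suitable.eight_le_incr (h : Problem d P.T P.ε P.β c) (hS : Suitable d P J c) {j : ℕ}
    (h1 : 1 ≤ j) (hj : j ≤ J) : 8 ≤ incr d P j := by
  have hg := alphaGamma_nonneg h.one_le_d h.two_le_T h.ε_pos h.β_pos h.β_le j
  have hL := hS.one_le_L j h1 hj
  have e := lg_three_mul_T_eq h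
  have := le_lg_three
  have := h.one_le_neg_lg_β
  have := one_le_lg_natCast h.two_le_T
  have h12 : 12 ≤ 12 / P.ε := by
    rw [le_div_iff₀ h.ε_pos]
    linarith [h.ε_le]
  have hp : (0 : ℝ) ≤ 2 ^ (j - 1) := by positivity
  unfold incr alphaDM
  nlinarith

theorem Suitable.fewSegments (h : Problem d P.T P.ε P.β c) (hS : Suitable d P J c) :
    FewSegments d P J where
  one_le_d := h.one_le_d
  two_le_T := h.two_le_T
  ε_pos := h.ε_pos
  β_pos := h.β_pos
  β_le := h.β_le
  pred_le_L := hS.pred_le_L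
  lt_lg_T := hS.lt_lg_T
  one_le_J := hS.one_le_J
  βIn_pos := hS.βIn_pos
  βIn_le := hS.βIn_le
  mul_βIn_le := hS.mul_βIn_le
  eight_le_incr _ h1 h2 := hS.eight_le_incr h h1 h2

theorem Suitable.one_le_lg_test (h : Problem d P.T P.ε P.β c) (hS : Suitable d P J c) :
    1 ≤ lg (3 * P.T / P.βIn) := by
  have hI := hS.βIn_pos
  have hT := h.two_le_T'
  have : 2 ≤ 3 * P.T / P.βIn := by
    rw [le_div_iff₀ hI]
    linarith [hS.βIn_le, h.β_le]
  have := lg_mono (by norm_num) this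
  rwa [lg_two] at this

theorem Suitable.inner_nonneg (h : Problem d P.T P.ε P.β c) (hS : Suitable d P J c) {j : ℕ}
    (h1 : 1 ≤ j) (h2 : j ≤ J) :
    0 ≤ treeErr d (P.ε / 2) P.βIn (incr d P j) ∧ 0 ≤ lg (3 * incr d P j / P.βIn) := by
  have hd := h.one_le_d'
  have hε := h.ε_pos
  have hI := hS.βIn_pos
  have hI1 : P.βIn ≤ 1 := by linarith [hS.βIn_le, h.β_le]
  have h8 := hS.eight_le_incr h h1 h2
  constructor
  · have := lg_nonneg (by linarith : 1 ≤ incr d P j)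
    have : 0 ≤ lg (6 * d * incr d P j / P.βIn) := by
      apply lg_nonneg
      rw [le_div_iff₀ hI]
      nlinarith
    unfold treeErr
    positivity
  · apply lg_nonneg
    rw [le_div_iff₀ hI]
    linarith

theorem Suitable.regular (h : Problem d P.T P.ε P.β c) (hS : Suitable d P J c) :
    Regular d P J c where
  one_le_d := h.one_le_d
  one_le_T := by linarith [h.two_le_T]
  ε_pos := h.ε_pos
  one_le_J := hS.one_le_J
  gamma_nonneg j _ _ := alphaGamma_nonneg h.one_le_d h.two_le_T h.ε_pos h.β_pos h.β_le j
  treeErr_nonneg _ h1 h2 := (hS.inner_nonneg h h1 h2).1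
  test_nonneg := by linarith [hS.one_le_lg_test h]
  threshold_nonneg _ h1 h2 := (hS.inner_nonneg h h1 h2).2
  three_le_gap j h1 h2 := by
    have hε := h.ε_pos
    have hg := alphaGamma_nonneg h.one_le_d h.two_le_T h.ε_pos h.β_pos h.β_le j
    obtain ⟨i1, i2⟩ := hS.inner_nonneg h h1 h2
    have i3 := hS.one_le_lg_test h
    have h8 : 8 ≤ 8 / P.ε := by
      rw [le_div_iff₀ hε]
      linarith [h.ε_le]
    have i4 : 0 ≤ 4 / P.ε * lg (3 * incr d P j / P.βIn) := by positivity
    unfold innerGap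
    nlinarith
  five_le_incr _ h1 h2 := by linarith [hS.eight_le_incr h h1 h2]
  le_incr j h1 h2 := by
    have hε := h.ε_pos
    have hg := alphaGamma_nonneg h.one_le_d h.two_le_T h.ε_pos h.β_pos h.β_le j
    have hL := hS.one_le_L j h1 h2
    have ho : 0 ≤ outerSlack P := by
      have : 0 ≤ lg (3 * P.T / P.β) := by
        rw [lg_three_mul_T_eq h]
        linarith [le_lg_three, h.one_le_neg_lg_β, one_le_lg_natCast h.two_le_T]
      unfold outerSlack
      positivity
    have : 12 / P.ε * lg (3 * P.T / P.β) = outerSlack P := rfl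
    unfold incr alphaDM
    rw [this]
    linarith
  succ_le := hS.succ_le

-- With W = log(d c/ε) + l and l = 1 + log Q, all terms of K except the inner comparison noise are
-- O((d/ε) W² log(d/β)); that one is O(l log(T/(εβ))/ε). `Problem.mul_sq_le` then replaces W² at the
-- price of 4l².
set_option maxHeartbeats 1000000 in
theorem Suitable.innerGap_le (h : Problem d P.T P.ε P.β c) (hS : Suitable d P J c) {j : ℕ}
    (h1 : 1 ≤ j) (hj : j ≤ J) (hr : Reachable d P c j) :
    3 * innerGap d P j ≤ errBound 81360 2 d P.T P.ε P.β c := by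
  have hd := h.one_le_d'
  have hε := h.ε_pos
  have hβ := h.β_pos
  have hc := h.one_le_c
  have hI := hS.βIn_pos
  have hT := h.two_le_T'
  have hlT := one_le_lg_natCast h.two_le_T
  have hb := h.one_le_neg_lg_β
  have hle := h.lg_ε_nonpos
  have hld := lg_nonneg hd
  have hA := h.lg_count_nonneg
  obtain ⟨hQ1, hQ2⟩ := h.lg_count_add_two_le
  have hlQ := h.one_le_lg_lg
  have hpow := hS.two_pow_le h hj hr
  have hΔ := hS.incr_le h hj hr
  have h8 := hS.eight_le_incr h h1 hj
  have hβI := hS.le_βIn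
  have hL := hS.L_le j
  have hL1 := hS.one_le_L j h1 hj
  have hB : lg (d / P.β) = lg d - lg P.β := lg_div (by linarith) hβ
  have hSv : lg (P.T / (P.ε * P.β)) = lg P.T - lg P.ε - lg P.β := by
    rw [lg_div (by linarith) (by positivity), lg_mul hε hβ]
    ring
  have hfin := h.mul_sq_le (l := 1 + lg (lg (d * P.T * c / (P.ε * P.β)))) (by linarith)
  have hgam := fun S (hS : √(P.L j) ≤ S) => TwoLevel.alphaGamma_le h hS
    (W := lg (d * c / P.ε) + (1 + lg (lg (d * P.T * c / (P.ε * P.β))))) (by linarith)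
  have hNpos : 0 < d * c / P.ε := by positivity
  rw [errBound]
  set Q := lg (d * P.T * c / (P.ε * P.β)) with hQ_def
  set A := lg (d * c / P.ε) with hA_def
  set l := 1 + lg Q with hl_def
  set W := A + l with hW_def
  set B := lg (d / P.β) with hB_def
  set S := lg (P.T / (P.ε * P.β)) with hS_def
  set Δ := incr d P j with hΔ_def
  have hQ0 : 0 < Q := by linarith
  have hB1 : 1 ≤ B := by linarith
  have hS1 : 1 ≤ S := by linarith
  have hl2 : 2 ≤ l := by linarith
  have hW2 : 2 ≤ W := by linarith
  have hΔ0 : 0 < Δ := by linarith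
  have hlgΔ0 : 0 ≤ lg Δ := lg_nonneg (by linarith)
  have hlgΔ : lg Δ ≤ 11 * W := by
    have := lg_le_of_le_mul hQ0 hNpos hΔ0 hΔ
    push_cast at this
    linarith
  -- `α_Γ`
  have hLW : P.L j ≤ 12 * W := by
    rcases hL with hL | hL
    · have hp : (2 : ℝ) ^ (j - 1) ≤ 2 ^ 10 * (d * c / P.ε) * Q ^ 2 := by
        refine hpow.trans ?_
        gcongr
        norm_num
      have := lg_le_of_le_mul hQ0 hNpos (by positivity) hp
      rw [lg_two_pow, Nat.cast_sub h1] at this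
      push_cast at this
      linarith
    · exact hL
  have hsqrt : √(P.L j) ≤ 12 * W := by
    rw [Real.sqrt_le_left (by linarith)]
    nlinarith
  have hWB : W ≤ W * B := le_mul_of_one_le_right (by linarith) hB1
  have hWB' : B ≤ W * B := le_mul_of_one_le_left (by linarith) (by linarith)
  have k1 : alphaGamma d P j ≤ 216 * ((d / P.ε) * (W ^ 2 * B)) := by
    refine (hgam _ hsqrt).trans ?_
    calc 6 * (12 * W) * (d / P.ε) * (W + 1 + B) ≤ 6 * (12 * W) * (d / P.ε) * (3 * (W * B)) := by
          gcongr
          linarith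
      _ = _ := by ring
  -- the inner failure probability
  have hinv : ∀ y, 0 < y → lg (y / P.βIn) ≤ lg y + 7 + lg Q - lg P.β := by
    intro y hy
    have e1 : lg P.β ≤ lg (72 * Q * P.βIn) := lg_mono hβ hβI
    rw [lg_mul (by positivity) hI, lg_mul (by norm_num) hQ0] at e1
    have e2 := lg_le_of_le_two_pow (y := 72) (n := 7) (by norm_num) (by norm_num)
    rw [lg_div hy hI]
    push_cast at e2
    linarith
  have l6 := lg_le_of_le_two_pow (y := 6) (n := 3) (by norm_num) (by norm_num)
  have l3 := lg_three_le
  push_cast at l6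
  have k2 : treeErr d (P.ε / 2) P.βIn Δ ≤ 1936 * ((d / P.ε) * (W ^ 2 * B)) := by
    have e1 : lg (6 * d * Δ / P.βIn) ≤ 22 * (W * B) := by
      have := hinv (6 * d * Δ) (by positivity)
      rw [lg_mul (by positivity) hΔ0, lg_mul (by norm_num) (by positivity)] at this
      linarith
    calc treeErr d (P.ε / 2) P.βIn Δ
        = 8 * (d / P.ε) * lg Δ * lg (6 * d * Δ / P.βIn) := by
          rw [treeErr]
          field_simp
          ring
      _ ≤ 8 * (d / P.ε) * lg Δ * (22 * (W * B)) := by gcongr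
      _ ≤ 8 * (d / P.ε) * (11 * W) * (22 * (W * B)) := by gcongr
      _ = _ := by ring
  have k3 : 8 / P.ε * lg (3 * P.T / P.βIn) ≤ 80 * (P.ε⁻¹ * (l * S)) := by
    have e1 : lg (3 * P.T / P.βIn) ≤ 10 * (l * S) := by
      have := hinv (3 * P.T) (by positivity)
      rw [lg_mul (by norm_num) (by positivity)] at this
      have q1 : l ≤ l * S := le_mul_of_one_le_right (by linarith) hS1
      have q2 : S ≤ l * S := le_mul_of_one_le_left (by linarith) (by linarith)
      linarith
    calc 8 / P.ε * lg (3 * P.T / P.βIn) ≤ 8 / P.ε * (10 * (l * S)) := by gcongr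
      _ = _ := by ring
  have k4 : 4 / P.ε * lg (3 * Δ / P.βIn) ≤ 88 * ((d / P.ε) * (W ^ 2 * B)) := by
    have e1 : lg (3 * Δ / P.βIn) ≤ 22 * (W * B) := by
      have := hinv (3 * Δ) (by positivity)
      rw [lg_mul (by norm_num) hΔ0] at this
      linarith
    calc 4 / P.ε * lg (3 * Δ / P.βIn) ≤ 4 / P.ε * (22 * (W * B)) := by gcongr
      _ = 88 * ((1 / P.ε) * (1 * W * B)) := by ring
      _ ≤ 88 * ((d / P.ε) * (W * W * B)) := by
        gcongr
        linarith
      _ = _ := by ring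
  have hdB : 0 ≤ d * B * A ^ 2 := by positivity
  have hlS : l * S ≤ l ^ 2 * (d * B * A ^ 2 + S) := by
    calc l * S ≤ l ^ 2 * S := by
          gcongr
          nlinarith
      _ ≤ _ := by
          gcongr
          linarith
  have m1 : (d / P.ε) * (W ^ 2 * B) ≤ P.ε⁻¹ * (4 * l ^ 2 * (d * B * A ^ 2 + S)) := by
    calc (d / P.ε) * (W ^ 2 * B) = P.ε⁻¹ * (d * W ^ 2 * B) := by ring
      _ ≤ _ := mul_le_mul_of_nonneg_left hfin (by positivity)
  have m2 : P.ε⁻¹ * (l * S) ≤ P.ε⁻¹ * (l ^ 2 * (d * B * A ^ 2 + S)) :=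
    mul_le_mul_of_nonneg_left hlS (by positivity)
  have hgap : innerGap d P j = 3 * (alphaGamma d P j + treeErr d (P.ε / 2) P.βIn Δ
    + 8 / P.ε * lg (3 * P.T / P.βIn) + 4 / P.ε * lg (3 * Δ / P.βIn)) := rfl
  rw [hgap]
  -- The constant is 9(4(216 + 1936 + 88) + 80) = 81360. One factor 3 is in the definition of K, the
  -- other in the output error.
  linarith

end

/-! ### The two choices of `L` -/

variable {d J : ℕ} {P : Params} {c : ℝ}

theorem isAccurate_of_suitable {x : ℕ → Fin d → Bool} (h : Problem d P.T P.ε P.β (cMax x P.T))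
    (hS : Suitable d P J (cMax x P.T)) :
    IsAccurate (noiseLaw d) P.T (maxSum x) (mechanism P x)
      (errBound 81360 2 d P.T P.ε P.β (cMax x P.T)) (2 * P.β) := by
  refine lt_of_le_of_lt (measure_mono fun ω hω => ?_) (noiseLaw_not_quiet_lt (hS.fewSegments h))
  intro hQ
  exact absurd (maxError_le_of_quiet (hS.regular h) hQ
    fun j h1 h2 hr => hS.innerGap_le h h1 h2 hr) (not_le.2 hω)

/-- The rule that a segment ends only if j < log T already caps the number of segments at ⌈log T⌉;
no knowledge of c is used. Rounding up costs at most a factor 2 in J βIn. -/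
theorem suitable_onlineParams {T : ℕ} {ε β : ℝ} (h : Problem d T ε β c) :
    Suitable d (onlineParams T ε β) ⌈lg T⌉₊ c := by
  have hT := one_le_lg_natCast h.two_le_T
  have hβ := h.β_pos
  have hJ := Nat.ceil_lt_add_one (by linarith : 0 ≤ lg T)
  refine
  { pred_le_L := fun j _ _ => by simp [onlineParams]
    one_le_L := fun j h1 _ => by simpa [onlineParams] using h1
    L_le := fun j => Or.inl le_rfl
    lt_lg_T := hJ
    one_le_J := Nat.one_le_ceil_iff.2 (by linarith)
    βIn_pos := ?_
    βIn_le := ?_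
    mul_βIn_le := ?_
    le_βIn := ?_
    succ_le := fun j _ _ hj => Nat.lt_ceil.2 hj.1 }
  · simp only [onlineParams]
    positivity
  · simp only [onlineParams]
    gcongr
    linarith
  · simp only [onlineParams]
    calc (⌈lg T⌉₊ : ℝ) * (β / (3 * lg T)) ≤ (2 * lg T) * (β / (3 * lg T)) := by
          gcongr
          linarith
      _ = 2 * β / 3 := by field_simp
  · simp only [onlineParams]
    have hQ := h.lg_count_add_two_le.1
    have hA := h.lg_count_nonneg
    have hb := h.one_le_neg_lg_β
    rw [mul_div_assoc', le_div_iff₀ (by positivity)]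
    nlinarith

/-! ### The segment bound computed from the maximum column sum -/

theorem segBound_eq (d T : ℕ) (ε β c : ℝ) :
    segBound d T ε β c = lg c + 4 * lg d + 5 * lg (lg T) + 2 * lg (12 / ε) + 2 * lg (-lg β) := by
  rw [segBound, lg_one_div]

theorem three_le_lg_twelve_div {T : ℕ} {ε β : ℝ} (h : Problem d T ε β c) : 3 ≤ lg (12 / ε) := by
  have : (2 : ℝ) ^ 3 ≤ 12 / ε := by
    rw [le_div_iff₀ h.ε_pos]
    linarith [h.ε_le]
  simpa using le_lg_of_two_pow_le this

theorem six_le_segBound {T : ℕ} {ε β : ℝ} (h : Problem d T ε β c) : 6 ≤ segBound d T ε β c := by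
  rw [segBound_eq]
  have := three_le_lg_twelve_div h
  have := lg_nonneg h.one_le_c
  have := lg_nonneg h.one_le_d'
  have := lg_nonneg (one_le_lg_natCast h.two_le_T)
  have := lg_nonneg h.one_le_neg_lg_β
  linarith

theorem segBound_le {T : ℕ} {ε β : ℝ} (h : Problem d T ε β c) :
    segBound d T ε β c
      ≤ 12 * (lg (d * c / ε) + (1 + lg (lg (d * T * c / (ε * β))))) := by
  rw [segBound_eq]
  have h1 := lg_nonneg h.one_le_c
  have h2 := lg_nonneg h.one_le_d'
  have hT := one_le_lg_natCast h.two_le_T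
  have hb := h.one_le_neg_lg_β
  have hε := h.lg_ε_nonpos
  have hA := h.lg_count_nonneg
  have hQ := h.lg_count_add_two_le.1
  have h3 := lg_mono (by linarith) (by linarith : lg T ≤ lg (d * T * c / (ε * β)))
  have h4 := lg_mono (by linarith) (by linarith : -lg β ≤ lg (d * T * c / (ε * β)))
  have h5 := lg_le_of_le_two_pow (y := 12) (n := 4) (by norm_num) (by norm_num)
  have h6 := h.lg_count
  have h7 := h.one_le_lg_lg
  rw [lg_div (by norm_num) h.ε_pos]
  push_cast at h5
  linarith

theorem lg_le_two_mul_sqrt {y : ℝ} (hy : 0 < y) : lg y ≤ 2 * √y := by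
  have h := lg_lt_self (Real.sqrt_pos.2 hy)
  have e : lg y = 2 * lg √y := by
    conv_lhs => rw [← Real.sq_sqrt hy.le]
    rw [lg_pow]
    norm_num
  linarith

/-- The numerical inequality behind the segment bound. -/
theorem segBound_capacity {c D τ e b : ℝ} (hc : 1 ≤ c) (hD : 1 ≤ D) (hτ : 3 / 2 ≤ τ)
    (he : 12 ≤ e) (hb : 1 ≤ b) :
    c + √2 / 3 * e * D * √(lg (c * D ^ 4 * τ ^ 5 * e ^ 2 * b ^ 2))
        * (lg 3 + lg D + lg τ + b) + e * (lg 3 + τ + b)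
      ≤ c * D ^ 4 * τ ^ 5 * e ^ 2 * b ^ 2 / 2 := by
  set V := e * D ^ 2 * τ ^ 2 * b with hV
  set X := c * D ^ 4 * τ ^ 5 * e ^ 2 * b ^ 2 with hX
  -- X is 2^L in the application. It is c τ V², so V ≤ √X, while the noise terms to be absorbed are
  -- controlled by V.
  have hXV : X = c * τ * V ^ 2 := by
    rw [hX, hV]
    ring
  have hV27 : 27 ≤ V := by
    calc (27 : ℝ) = 12 * 1 ^ 2 * (3 / 2) ^ 2 * 1 := by norm_num
      _ ≤ e * D ^ 2 * τ ^ 2 * b := by gcongr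
  have hX0 : 0 < X := by positivity
  have hVX : V ^ 2 ≤ X := by
    rw [hXV]
    have : 1 ≤ c * τ := by nlinarith
    exact le_mul_of_one_le_left (by positivity) this
  have hR : √X * √X = X := Real.mul_self_sqrt hX0.le
  have hVR : V ≤ √X := Real.le_sqrt_of_sq_le hVX
  set R := √X with hR_def
  -- From log X ≤ 2R and R ≥ 27, as 0.2723² · 27 > 2.
  have hL : √(lg X) ≤ 0.2723 * R := by
    have := lg_le_two_mul_sqrt hX0
    rw [Real.sqrt_le_left (by linarith)]
    nlinarith
  have h2 : √2 ≤ 1.4143 := by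
    rw [Real.sqrt_le_left (by norm_num)]
    norm_num
  have hl3 := lg_three_le
  have hlD := lg_lt_self (by linarith : 0 < D)
  have hlτ := lg_lt_self (by linarith : 0 < τ)
  have hDτ : 1 ≤ D * τ := by nlinarith
  have hτb : 1 ≤ τ * b := by nlinarith
  have hDb : 1 ≤ D * b := by nlinarith
  have hDle : D ≤ D * τ * b := by
    rw [mul_assoc]
    exact le_mul_of_one_le_right (by linarith) hτb
  have hbτ : τ ≤ τ * b := le_mul_of_one_le_right (by linarith) hb
  have hbτ' : b ≤ τ * b := le_mul_of_one_le_left (by linarith) (by linarith)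
  have hDτb : τ * b ≤ D * τ * b := by
    rw [mul_assoc]
    exact le_mul_of_one_le_left (by positivity) hD
  have s1 : lg 3 + lg D + lg τ + b ≤ 4.6 * (D * τ * b) := by linarith
  have s1' : 0 ≤ lg 3 + lg D + lg τ + b := by
    have := lg_nonneg hD
    have := lg_nonneg (by linarith : 1 ≤ τ)
    have := le_lg_three
    linarith
  have hVτ : e * D * (D * τ * b) ≤ 2 / 3 * R := by
    have : e * D * (D * τ * b) * (3 / 2) ≤ V := by
      calc e * D * (D * τ * b) * (3 / 2) ≤ e * D * (D * τ * b) * τ := by gcongr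
        _ = V := by
          rw [hV]
          ring
    linarith
  have t1 : √2 / 3 * e * D * √(lg X) * (lg 3 + lg D + lg τ + b) ≤ 0.4 * X := by
    calc √2 / 3 * e * D * √(lg X) * (lg 3 + lg D + lg τ + b)
        ≤ 1.4143 / 3 * e * D * (0.2723 * R) * (4.6 * (D * τ * b)) := by gcongr
      _ = 1.4143 / 3 * 0.2723 * 4.6 * R * (e * D * (D * τ * b)) := by ring
      _ ≤ 1.4143 / 3 * 0.2723 * 4.6 * R * (2 / 3 * R) := by gcongr
      _ = 1.4143 / 3 * 0.2723 * 4.6 * (2 / 3) * X := by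
        rw [← hR]
        ring
      _ ≤ 0.4 * X := by
        gcongr
        norm_num
  have t2 : e * (lg 3 + τ + b) ≤ 0.09 * X := by
    have : e * (lg 3 + τ + b) ≤ 3.6 * (e * D * (D * τ * b)) := by
      calc e * (lg 3 + τ + b) ≤ e * (3.6 * (D * τ * b)) := by
            gcongr
            linarith
        _ = 3.6 * (e * 1 * (D * τ * b)) := by ring
        _ ≤ 3.6 * (e * D * (D * τ * b)) := by gcongr
    nlinarith
  have t3 : c ≤ 0.01 * X := by
    rw [hXV]
    have : 100 ≤ τ * V ^ 2 := by nlinarith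
    nlinarith
  -- The three shares 0.4, 0.09 and 0.01 of X add up to exactly X/2.
  linarith

/-- The number of segments obeys two caps. One is log T as before. The other is L + 1: a segment
that ends has 2^(j-1) ≤ 2^L/2, hence j ≤ L. -/
theorem suitable_fixedParams {T : ℕ} {ε β : ℝ} (h : Problem d T ε β c) :
    Suitable d (fixedParams d T ε β c) (min ⌈lg T⌉₊ (⌊segBound d T ε β c⌋₊ + 1)) c := by
  have hT := one_le_lg_natCast h.two_le_T
  have hβ := h.β_pos
  have hε := h.ε_pos
  have hc := h.one_le_c
  have hd := h.one_le_d'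
  have hb := h.one_le_neg_lg_β
  have hJ := Nat.ceil_lt_add_one (by linarith : 0 ≤ lg T)
  have h6 := six_le_segBound h
  have hle := segBound_le h
  have hfl := Nat.floor_le (by linarith : 0 ≤ segBound d T ε β c)
  have e := segBound_eq d T ε β c
  set L := segBound d T ε β c with hL
  have hJL : ((min ⌈lg T⌉₊ (⌊L⌋₊ + 1) : ℕ) : ℝ) ≤ L + 1 := by
    have : ((min ⌈lg T⌉₊ (⌊L⌋₊ + 1) : ℕ) : ℝ) ≤ (⌊L⌋₊ + 1 : ℕ) := by
      exact_mod_cast min_le_right _ _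
    push_cast at this ⊢
    linarith
  refine
  { pred_le_L := fun j _ hj => ?_
    one_le_L := fun j _ _ => by
      change 1 ≤ L
      linarith
    L_le := fun j => Or.inr hle
    lt_lg_T := ?_
    one_le_J := le_min (Nat.one_le_ceil_iff.2 (by linarith)) (by omega)
    βIn_pos := ?_
    βIn_le := ?_
    mul_βIn_le := ?_
    le_βIn := ?_
    succ_le := fun j h1 _ hj => ?_ }
  · change (j : ℝ) - 1 ≤ L
    have : (j : ℝ) ≤ (min ⌈lg T⌉₊ (⌊L⌋₊ + 1) : ℕ) := by exact_mod_cast hj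
    linarith
  · refine lt_of_le_of_lt ?_ hJ
    exact_mod_cast min_le_left _ _
  · change 0 < β / (3 * L)
    positivity
  · change β / (3 * L) ≤ β / 3
    gcongr
    linarith
  · change _ * (β / (3 * L)) ≤ 2 * β / 3
    calc _ ≤ (2 * L) * (β / (3 * L)) := by
          gcongr
          linarith
      _ = 2 * β / 3 := by field_simp
  · change β ≤ 72 * lg (d * T * c / (ε * β)) * (β / (3 * L))
    obtain ⟨h1, h2⟩ := h.lg_count_add_two_le
    have hA := h.lg_count_nonneg
    have hQ := lg_lt_self (by linarith : 0 < lg (d * T * c / (ε * β)))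
    rw [mul_div_assoc', le_div_iff₀ (by positivity)]
    nlinarith
  · obtain ⟨hj1, hj2⟩ := hj
    change (j : ℝ) < lg T at hj1
    refine le_min (Nat.lt_ceil.2 hj1) (Nat.succ_le_succ (Nat.le_floor ?_))
    -- A segment can end only if 1 ≤ j < log T, which rules out T = 2, where log T would be too
    -- small for the capacity inequality.
    have hτ : 3 / 2 ≤ lg T := by
      have h3 : 3 ≤ T := by
        by_contra hlt
        have : T = 2 := by
          have := h.two_le_T
          omega
        rw [this, Nat.cast_ofNat, lg_two] at hj1
        have : (1 : ℝ) ≤ j := by exact_mod_cast h1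
        linarith
      have h3' : (3 : ℝ) ≤ T := by exact_mod_cast h3
      exact le_lg_three.trans (lg_mono (by norm_num) h3')
    have he : 12 ≤ 12 / ε := by
      rw [le_div_iff₀ hε]
      linarith [h.ε_le]
    have hcap := segBound_capacity hc hd hτ he hb
    have hLX : lg (c * d ^ 4 * lg T ^ 5 * (12 / ε) ^ 2 * (-lg β) ^ 2) = L := by
      rw [e, lg_mul (by positivity) (by positivity), lg_mul (by positivity) (by positivity),
        lg_mul (by positivity) (by positivity), lg_mul (by positivity) (by positivity)]
      simp only [lg_pow]
      push_cast
      ring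
    have hg : alphaGamma d (fixedParams d T ε β c) j
        = √2 / 3 * (12 / ε) * d * √L * (lg 3 + lg d + lg (lg T) + -lg β) := by
      have := lg_gamma_eq (P := fixedParams d T ε β c) h
      rw [alphaGamma, this]
      simp only [fixedParams]
      ring
    have ho : outerSlack (fixedParams d T ε β c) = 12 / ε * (lg 3 + lg T + -lg β) := by
      have := lg_three_mul_T_eq (P := fixedParams d T ε β c) h
      rw [outerSlack, this]
      simp only [fixedParams]
      ring
    rw [hLX] at hcap
    rw [hg, ho] at hj2
    have hX : (2 : ℝ) ^ j ≤ c * d ^ 4 * lg T ^ 5 * (12 / ε) ^ 2 * (-lg β) ^ 2 := by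
      have : (2 : ℝ) ^ j = 2 * 2 ^ (j - 1) := by rw [← pow_succ', Nat.sub_add_cancel h1]
      linarith
    rw [← hLX]
    exact le_lg_of_two_pow_le hX

/-- Disposes of β > 1/2, so that the main argument may use log(1/β) ≥ 1. -/
theorem isAccurate_of_half_lt {Ω : Type*} [MeasurableSpace Ω] (μ : Measure Ω)
    [IsProbabilityMeasure μ] (T : ℕ) (q : ℕ → ℝ) (A : Ω → ℕ → ℝ) (α : ℝ) {β : ℝ}
    (hβ : 1 / 2 < β) : IsAccurate μ T q A α (2 * β) := by
  refine lt_of_le_of_lt prob_le_one ?_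
  rw [← ENNReal.ofReal_one, ENNReal.ofReal_lt_ofReal_iff (by linarith)]
  linarith

end TwoLevel

theorem mainTheorem9 :
    ∃ C : ℝ, 0 < C ∧ ∃ k : ℕ, ∀ (d T : ℕ) (ε β : ℝ) (x : ℕ → Fin d → Bool),
      1 ≤ d → 2 ≤ T → 0 < ε → ε ≤ 1 → 0 < β → β < 1 →
      -- the mechanism that knows nothing about `c_max` is accurate
      TwoLevel.IsAccurate (TwoLevel.noiseLaw d) T (TwoLevel.maxSum x)
        (TwoLevel.mechanism (TwoLevel.onlineParams T ε β) x)
        (TwoLevel.errBound C k d T ε β (TwoLevel.cMax x T)) (2 * β) ∧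
      -- its output at time `t` depends on the stream only through the first `t` rows
      (∀ (y : ℕ → Fin d → Bool) (t : ℕ), (∀ t', 1 ≤ t' → t' ≤ t → x t' = y t') →
        ∀ ω, TwoLevel.mechanism (TwoLevel.onlineParams T ε β) x ω t
          = TwoLevel.mechanism (TwoLevel.onlineParams T ε β) y ω t) ∧
      -- the mechanism with `L` fixed in advance through `c_max` is accurate
      TwoLevel.IsAccurate (TwoLevel.noiseLaw d) T (TwoLevel.maxSum x)
        (TwoLevel.mechanism (TwoLevel.fixedParams d T ε β (TwoLevel.cMax x T)) x)
        (TwoLevel.errBound C k d T ε β (TwoLevel.cMax x T)) (2 * β) := by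
  refine ⟨81360, by norm_num, 2, fun d T ε β x hd hT hε hε1 hβ hβ1 => ?_⟩
  refine ⟨?_, fun y t hxy ω => ?_, ?_⟩
  · rcases le_or_gt β (1 / 2) with h | h
    · have hp : TwoLevel.Problem d T ε β (TwoLevel.cMax x T) :=
        ⟨hd, hT, hε, hε1, hβ, h, le_max_left _ _⟩
      exact TwoLevel.isAccurate_of_suitable (P := TwoLevel.onlineParams T ε β) hp
        (TwoLevel.suitable_onlineParams hp)
    · exact TwoLevel.isAccurate_of_half_lt _ _ _ _ _ h
  · rw [TwoLevel.mechanism, TwoLevel.mechanism, TwoLevel.stateAt_congr _ ω hxy]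
  · rcases le_or_gt β (1 / 2) with h | h
    · have hp : TwoLevel.Problem d T ε β (TwoLevel.cMax x T) :=
        ⟨hd, hT, hε, hε1, hβ, h, le_max_left _ _⟩
      exact TwoLevel.isAccurate_of_suitable
        (P := TwoLevel.fixedParams d T ε β (TwoLevel.cMax x T)) hp
        (TwoLevel.suitable_fixedParams hp)
    · exact TwoLevel.isAccurate_of_half_lt _ _ _ _ _ h
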